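/- **Setting.** Let $\mathcal T=(V,E,F)$ be an infinite, locally finite (simplicial) triangulation of the open disk, with vertex, edge and face sets $V,E,F$, and let $\Phi:E\to[0,\frac{\pi}{2}]$ be an intersection angle. A (hyperbolic) discrete conformal factor is a function $u\in(-\infty,0)^V$; it corresponds to the radii $r\in(0,\infty)^V$ with $u_i=\ln\tanh\frac{r_i}{2}$. It gives the edge $\{i,j\}\in E$ the length $$l_{ij}=\cosh^{-1}\bigl(\cosh r_i\cosh r_j+\cos\Phi_{ij}\,\sinh r_i\sinh r_j\bigr),$$ and each face $\{i,j,k\}\in F$ the inner angles of the hyperbolic triangle with side lengths $l_{ij},l_{jk},l_{ik}$; let $\theta_i^{jk}$ be the angle at $i$. The discrete Gaussian curvature is $$K_i(u)=2\pi-\sum_{\{i,j,k\}\in F}\theta_i^{jk},\qquad i\in V.$$ **Theorem 4.2.** Let $\hat K\in(-\infty,2\pi)^V$, and let $u(0)\in(-\infty,0)^V$ be a discrete conformal factor with $K_i(u(0))\le\hat K_i$ for every $i\in V$. Then there is a solution $u(t)\in(-\infty,0)^V$, $t\in[0,\infty)$, of the flow $$\frac{du_i}{dt}=-(K_i(u)-\hat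 K_i),\qquad i\in V,$$ with initial value $u(0)$, which converges as $t\to\infty$, at every vertex, to a discrete conformal factor $u^*\in(-\infty,0)^V$ with $K_i(u^*)=\hat K_i$ for every $i\in V$. Moreover, if $K(u(0))$ is bounded on $V$, then among the solutions on $[0,\infty)$ with initial value $u(0)$ there is exactly one whose curvature $K_i(u(t))$ is bounded on $V\times[0,\infty)$; for this solution $u_i(t)$ and $K_i(u(t))$ are $C^\infty$ in $t\in[0,\infty)$ for every $i\in V$. -/

import Mathlib

noncomputable section

namespace CirclePacking

variable {V : Type*}

/-! ### Disk triangulations -/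

/-- The edges of a simplicial complex, as unordered pairs of distinct vertices. -/
def edges (T : AbstractSimplicialComplex V) : Set (Sym2 V) :=
  {e | ∃ i j : V, i ≠ j ∧ e = s(i, j) ∧ ∃ σ ∈ T, (σ : Set V) = {i, j}}

/-- `i`, `j`, `k` are the three (distinct) vertices of a triangle of `T`. -/
def IsFace (T : AbstractSimplicialComplex V) (i j k : V) : Prop :=
  i ≠ j ∧ i ≠ k ∧ j ≠ k ∧ ∃ σ ∈ T, (σ : Set V) = {i, j, k}

/-- The geometric realization of a simplicial complex, through barycentric coordinates: the points
of a simplex `σ` are the families of nonnegative weights supported in `σ` with sum `1`. It carries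
the topology induced from the product `V → ℝ`; for a locally finite complex this is the usual (weak)
topology, because the open star of every simplex lies in a finite subcomplex. -/
def realization (T : AbstractSimplicialComplex V) : Set (V → ℝ) :=
  {x | (∀ v, 0 ≤ x v) ∧ ∃ σ ∈ T, (∀ v, v ∉ σ → x v = 0) ∧ ∑ v ∈ σ, x v = 1}

/-- `T` is an infinite, locally finite triangulation of the open disk. -/
structure IsInfiniteDiskTriangulation (T : AbstractSimplicialComplex V) : Prop where
  /-- there are infinitely many vertices -/
  infinite : Infinite V
  /-- every vertex lies in finitely many simplices only -/
  locallyFinite : ∀ v : V, {σ : Finset V | σ ∈ T ∧ v ∈ σ}.Finite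
  /-- all simplices are vertices, edges or triangles -/
  card_le : ∀ σ ∈ T, σ.card ≤ 3
  /-- the underlying space is an open disk -/
  disk : Nonempty (realization T ≃ₜ Metric.ball (0 : EuclideanSpace ℝ (Fin 2)) 1)

/-! ### Hyperbolic circle-packing metrics and their curvature -/

/-- The hyperbolic radius `r` belonging to a conformal factor `u = ln (tanh (r / 2)) < 0`. -/
def radius (u : ℝ) : ℝ := 2 * Real.artanh (Real.exp u)

theorem log_tanh_radius {u : ℝ} (hu : u < 0) : Real.log (Real.tanh (radius u / 2)) = u := by
  have h1 : Real.exp u < 1 := by simpa using Real.exp_lt_exp.2 hu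
  have h0 : 0 < Real.exp u := Real.exp_pos u
  rw [radius, mul_div_cancel_left₀ _ (two_ne_zero), Real.tanh_artanh ⟨by linarith, h1⟩,
    Real.log_exp]

theorem radius_log_tanh (r : ℝ) (hr : 0 < r) : radius (Real.log (Real.tanh (r / 2))) = r := by
  have h0 : 0 < Real.tanh (r / 2) := by
    rw [Real.tanh_eq_sinh_div_cosh]
    exact div_pos (Real.sinh_pos_iff.2 (by linarith)) (Real.cosh_pos _)
  rw [radius, Real.exp_log h0, Real.artanh_tanh]
  ring

/-- The hyperbolic length of the edge `{i, j}`, for radii `r` and intersection angles `Φ`. -/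
def edgeLength (Φ : Sym2 V → ℝ) (r : V → ℝ) (i j : V) : ℝ :=
  Real.arcosh (Real.cosh (r i) * Real.cosh (r j)
    + Real.cos (Φ s(i, j)) * Real.sinh (r i) * Real.sinh (r j))

theorem edgeLength_comm (Φ : Sym2 V → ℝ) (r : V → ℝ) (i j : V) :
    edgeLength Φ r i j = edgeLength Φ r j i := by
  unfold edgeLength
  rw [Sym2.eq_swap]
  congr 1
  ring

/-- The angle, opposite to the side of length `a`, of the hyperbolic triangle with side lengths
`a`, `b`, `c` (hyperbolic law of cosines). -/
def hyperbolicAngle (a b c : ℝ) : ℝ :=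
  Real.arccos ((Real.cosh b * Real.cosh c - Real.cosh a) / (Real.sinh b * Real.sinh c))

/-- The inner angle at the vertex `i` of the triangle with vertices `i`, `j`, `k`. -/
def innerAngle (Φ : Sym2 V → ℝ) (r : V → ℝ) (i j k : V) : ℝ :=
  hyperbolicAngle (edgeLength Φ r j k) (edgeLength Φ r i j) (edgeLength Φ r i k)

theorem innerAngle_comm (Φ : Sym2 V → ℝ) (r : V → ℝ) (i j k : V) :
    innerAngle Φ r i j k = innerAngle Φ r i k j := by
  unfold innerAngle hyperbolicAngle
  rw [edgeLength_comm Φ r j k, mul_comm (Real.cosh _) (Real.cosh _),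
    mul_comm (Real.sinh _) (Real.sinh _)]

/-- The inner angle at `i`, as a function of the side `{j, k}` opposite to `i`. -/
def innerAngleOpp (Φ : Sym2 V → ℝ) (r : V → ℝ) (i : V) : Sym2 V → ℝ :=
  Sym2.lift ⟨fun j k => innerAngle Φ r i j k, fun j k => innerAngle_comm Φ r i j k⟩

/-- The sides opposite to `i` of the triangles of `T` that have `i` as a vertex; each such triangle
gives exactly one. -/
def oppositeSides (T : AbstractSimplicialComplex V) (i : V) : Set (Sym2 V) :=
  {e | ∃ j k : V, e = s(j, k) ∧ IsFace T i j k}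

/-- In a locally finite complex the sum in `curvature` below is a finite one. -/
theorem oppositeSides_finite (T : AbstractSimplicialComplex V) (i : V)
    (h : {σ : Finset V | σ ∈ T ∧ i ∈ σ}.Finite) : (oppositeSides T i).Finite := by
  have hfin : (⋃ σ ∈ {σ : Finset V | σ ∈ T ∧ i ∈ σ}, ((σ : Set V) ×ˢ (σ : Set V))).Finite :=
    h.biUnion fun σ _ => (σ.finite_toSet).prod (σ.finite_toSet)
  refine (hfin.image fun p : V × V => s(p.1, p.2)).subset ?_
  rintro e ⟨j, k, rfl, -, -, -, σ, hσ, hs⟩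
  have hi : i ∈ (σ : Set V) := by rw [hs]; simp
  have hj : j ∈ (σ : Set V) := by rw [hs]; simp
  have hk : k ∈ (σ : Set V) := by rw [hs]; simp
  refine ⟨(j, k), ?_, rfl⟩
  simp only [Set.mem_iUnion]
  exact ⟨σ, ⟨hσ, by exact_mod_cast hi⟩, hj, hk⟩

/-- The discrete Gaussian curvature at `i` of the hyperbolic circle-packing metric with radii `r`:
`2π` minus the sum of the inner angles at `i`, over the triangles of `T` that contain `i`. -/
def curvature (T : AbstractSimplicialComplex V) (Φ : Sym2 V → ℝ) (r : V → ℝ) (i : V) : ℝ :=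
  2 * Real.pi - ∑ᶠ e ∈ oppositeSides T i, innerAngleOpp Φ r i e

/-- `K_i(u)`: the curvature at `i` of the metric with discrete conformal factor `u`. -/
def K (T : AbstractSimplicialComplex V) (Φ : Sym2 V → ℝ) (u : V → ℝ) (i : V) : ℝ :=
  curvature T Φ (fun j => radius (u j)) i

/-- Discrete conformal factors in hyperbolic background geometry. -/
def IsConformalFactor (u : V → ℝ) : Prop := ∀ i, u i < 0

/-! ### The flow with prescribed curvature -/

/-- `u(t)`, `t ∈ [0, ∞)`, is a family of hyperbolic conformal factors which solves
`du_i/dt = -(K_i(u) - K̂_i)` for all vertices `i` and all `t ≥ 0` (with the one-sided derivative at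
`t = 0`). The values of `u` at negative times play no role. -/
structure IsFlowSolution (T : AbstractSimplicialComplex V) (Φ : Sym2 V → ℝ) (Khat : V → ℝ)
    (u : ℝ → V → ℝ) : Prop where
  conformal : ∀ t, 0 ≤ t → IsConformalFactor (u t)
  flow : ∀ t, 0 ≤ t → ∀ i,
    HasDerivWithinAt (fun s => u s i) (-(K T Φ (u t) i - Khat i)) (Set.Ici 0) t

/-- The curvature is bounded on `V × [0, ∞)`. -/
def HasBoundedCurvature (T : AbstractSimplicialComplex V) (Φ : Sym2 V → ℝ)
    (u : ℝ → V → ℝ) : Prop :=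
  ∃ C : ℝ, ∀ t, 0 ≤ t → ∀ i, |K T Φ (u t) i| ≤ C

/-- Smoothness in time on `[0, ∞)`, at every vertex. -/
def IsSmoothInTime (f : ℝ → V → ℝ) : Prop :=
  ∀ i, ContDiffOn ℝ (⊤ : ℕ∞) (fun t => f t i) (Set.Ici 0)

end CirclePacking

end

noncomputable section

namespace CirclePacking

/-! Let θ be the angle at vertex 1 of a triangle. In the coordinates `u` one has ∂θ/∂u₂ = p ≥ 0,
∂θ/∂u₃ = q ≥ 0 and ∂θ/∂u₁ = -(p cosh l₁₂ + q cosh l₁₃) (`hasDerivAt_angle`, `angleRate_nonneg`); the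
signs hold because the intersection angles have nonnegative cosines. So the flow is a cooperative
system with the initial value as subsolution. The angle at a large circle is small uniformly in the
other two radii (`angle_le_arccos`), so a supersolution `b` above `u₀` can be chosen vertex by
vertex. Monotone iteration on the order interval between them (`IsCooperativeOn.exists_solution`)
yields a solution that is nondecreasing in time; its constants `L i` may depend on the vertex, so no
uniformity over `V` is needed. Bounded by `b`, it converges to a conformal factor, and its velocity,
which converges too, must tend to 0.

Curvature bound: as the hyperbolic cosines of the edge lengths are at least 1, raising all factors
by the same amount does not increase the angles. Carried through the iteration, this keeps the
velocity below any upper bound of its initial values, which bounds the curvature from below.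

Uniqueness: p and q are at most 4θ (`angleRate_le`). This gives a Harnack inequality
(`two_pi_sub_K_le`) and, once the curvature is bounded, a one-sided Lipschitz estimate in the sup
distance that does not depend on the vertex degree. A barrier argument then halves any bound on the
difference of two solutions, repeatedly. Smoothness is a bootstrap, each curvature being a smooth
function of finitely many factors. -/

/-! ### Three mutually intersecting circles: algebraic identities and estimates

In this section `c i`, `s i` stand for the hyperbolic cosine and sine of three radii, `α`, `β`, `γ`
for the cosines of the intersection angles opposite to the vertices `1`, `2`, `3`. -/

/-- The hyperbolic cosine of the distance of the centers of two circles. -/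
def centerCosh (φ c s c' s' : ℝ) : ℝ := c * c' + φ * s * s'

theorem centerCosh_comm (φ c s c' s' : ℝ) : centerCosh φ c s c' s' = centerCosh φ c' s' c s := by
  unfold centerCosh; ring

/-- Minus the Gram determinant of the vertices of the triangle whose sides have hyperbolic
cosines `A`, `B`, `G`. -/
def gramDet (A B G : ℝ) : ℝ := 1 + 2 * A * B * G - A ^ 2 - B ^ 2 - G ^ 2

/-- The part of the Gram determinant of the three centers which is quadratic in the `c i`. -/
def gramQuad (α β γ c₁ s₁ c₂ s₂ c₃ s₃ : ℝ) : ℝ :=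
  (1 - α ^ 2) * (c₁ * s₂ * s₃) ^ 2 + (1 - β ^ 2) * (c₂ * s₁ * s₃) ^ 2
    + (1 - γ ^ 2) * (c₃ * s₁ * s₂) ^ 2
    + 2 * (γ + α * β) * (c₁ * c₂ * s₁ * s₂ * s₃ ^ 2)
    + 2 * (β + α * γ) * (c₁ * c₃ * s₁ * s₃ * s₂ ^ 2)
    + 2 * (α + β * γ) * (c₂ * c₃ * s₂ * s₃ * s₁ ^ 2)

section Algebra

variable {α β γ c₁ s₁ c₂ s₂ c₃ s₃ : ℝ}

theorem gramDet_centerCosh (h₁ : c₁ ^ 2 = s₁ ^ 2 + 1) (h₂ : c₂ ^ 2 = s₂ ^ 2 + 1)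
    (h₃ : c₃ ^ 2 = s₃ ^ 2 + 1) :
    gramDet (centerCosh α c₂ s₂ c₃ s₃) (centerCosh β c₁ s₁ c₃ s₃) (centerCosh γ c₁ s₁ c₂ s₂) =
      (α ^ 2 + β ^ 2 + γ ^ 2 + 2 * α * β * γ - 1) * (s₁ * s₂ * s₃) ^ 2
        + gramQuad α β γ c₁ s₁ c₂ s₂ c₃ s₃ := by
  unfold gramDet centerCosh gramQuad
  have e₁ : s₁ ^ 2 = c₁ ^ 2 - 1 := by linarith
  have e₂ : s₂ ^ 2 = c₂ ^ 2 - 1 := by linarith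
  have e₃ : s₃ ^ 2 = c₃ ^ 2 - 1 := by linarith
  ring_nf
  simp only [e₁, e₂, e₃]
  ring

/-- Replacing each `c` by the smaller `s` in `gramQuad` leaves (s₁s₂s₃)² with coefficient 2 plus
nonnegative products of α, β, γ. Positivity makes the triangle nondegenerate. -/
theorem gramDet_lower (hα : α ∈ Set.Icc (0 : ℝ) 1) (hβ : β ∈ Set.Icc (0 : ℝ) 1)
    (hγ : γ ∈ Set.Icc (0 : ℝ) 1) (h₁ : c₁ ^ 2 = s₁ ^ 2 + 1) (h₂ : c₂ ^ 2 = s₂ ^ 2 + 1)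
    (h₃ : c₃ ^ 2 = s₃ ^ 2 + 1) (p₁ : 0 < s₁) (p₂ : 0 < s₂) (p₃ : 0 < s₃)
    (q₁ : 0 < c₁) (q₂ : 0 < c₂) (q₃ : 0 < c₃) :
    2 * (s₁ * s₂ * s₃) ^ 2 ≤ gramDet (centerCosh α c₂ s₂ c₃ s₃) (centerCosh β c₁ s₁ c₃ s₃)
      (centerCosh γ c₁ s₁ c₂ s₂) := by
  obtain ⟨a0, a1⟩ := hα
  obtain ⟨b0, b1⟩ := hβ
  obtain ⟨g0, g1⟩ := hγ
  have l₁ : s₁ ≤ c₁ := abs_le_of_sq_le_sq' (by linarith) q₁.le |>.2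
  have l₂ : s₂ ≤ c₂ := abs_le_of_sq_le_sq' (by linarith) q₂.le |>.2
  have l₃ : s₃ ≤ c₃ := abs_le_of_sq_le_sq' (by linarith) q₃.le |>.2
  rw [gramDet_centerCosh h₁ h₂ h₃]
  have t₁ : (1 - α ^ 2) * (s₁ * s₂ * s₃) ^ 2 ≤ (1 - α ^ 2) * (c₁ * s₂ * s₃) ^ 2 := by
    have : 0 ≤ 1 - α ^ 2 := by nlinarith
    gcongr
  have t₂ : (1 - β ^ 2) * (s₁ * s₂ * s₃) ^ 2 ≤ (1 - β ^ 2) * (c₂ * s₁ * s₃) ^ 2 := by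
    have : 0 ≤ 1 - β ^ 2 := by nlinarith
    rw [mul_comm s₁ s₂]
    gcongr
  have t₃ : (1 - γ ^ 2) * (s₁ * s₂ * s₃) ^ 2 ≤ (1 - γ ^ 2) * (c₃ * s₁ * s₂) ^ 2 := by
    have : 0 ≤ 1 - γ ^ 2 := by nlinarith
    rw [show s₁ * s₂ * s₃ = s₃ * s₁ * s₂ by ring]
    gcongr
  have t₄ : 2 * (γ + α * β) * (s₁ * s₂ * s₃) ^ 2
      ≤ 2 * (γ + α * β) * (c₁ * c₂ * s₁ * s₂ * s₃ ^ 2) := by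
    rw [show (s₁ * s₂ * s₃) ^ 2 = s₁ * s₂ * s₁ * s₂ * s₃ ^ 2 by ring]
    gcongr
  have t₅ : 2 * (β + α * γ) * (s₁ * s₂ * s₃) ^ 2
      ≤ 2 * (β + α * γ) * (c₁ * c₃ * s₁ * s₃ * s₂ ^ 2) := by
    rw [show (s₁ * s₂ * s₃) ^ 2 = s₁ * s₃ * s₁ * s₃ * s₂ ^ 2 by ring]
    gcongr
  have t₆ : 2 * (α + β * γ) * (s₁ * s₂ * s₃) ^ 2
      ≤ 2 * (α + β * γ) * (c₂ * c₃ * s₂ * s₃ * s₁ ^ 2) := by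
    rw [show (s₁ * s₂ * s₃) ^ 2 = s₂ * s₃ * s₂ * s₃ * s₁ ^ 2 by ring]
    gcongr
  have hP : 0 ≤ (s₁ * s₂ * s₃) ^ 2 := sq_nonneg _
  have hk : 0 ≤ (α + β + γ + α * β + β * γ + γ * α + α * β * γ) * (s₁ * s₂ * s₃) ^ 2 := by
    positivity
  unfold gramQuad
  linarith

/-- The determinant falls below `gramQuad` by at most (s₁s₂s₃)², which is at most half the
determinant. Estimates can thus be made against a sum of nonnegative terms. -/
theorem gramQuad_le (hα : α ∈ Set.Icc (0 : ℝ) 1) (hβ : β ∈ Set.Icc (0 : ℝ) 1)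
    (hγ : γ ∈ Set.Icc (0 : ℝ) 1) (h₁ : c₁ ^ 2 = s₁ ^ 2 + 1) (h₂ : c₂ ^ 2 = s₂ ^ 2 + 1)
    (h₃ : c₃ ^ 2 = s₃ ^ 2 + 1) (p₁ : 0 < s₁) (p₂ : 0 < s₂) (p₃ : 0 < s₃)
    (q₁ : 0 < c₁) (q₂ : 0 < c₂) (q₃ : 0 < c₃) :
    2 * gramQuad α β γ c₁ s₁ c₂ s₂ c₃ s₃ ≤ 3 * gramDet (centerCosh α c₂ s₂ c₃ s₃)
      (centerCosh β c₁ s₁ c₃ s₃) (centerCosh γ c₁ s₁ c₂ s₂) := by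
  have hl := gramDet_lower hα hβ hγ h₁ h₂ h₃ p₁ p₂ p₃ q₁ q₂ q₃
  have he := gramDet_centerCosh (α := α) (β := β) (γ := γ) h₁ h₂ h₃
  obtain ⟨a0, a1⟩ := hα
  obtain ⟨b0, b1⟩ := hβ
  obtain ⟨g0, g1⟩ := hγ
  have hk : 0 ≤ (α ^ 2 + β ^ 2 + γ ^ 2 + 2 * α * β * γ) * (s₁ * s₂ * s₃) ^ 2 := by positivity
  linarith

theorem centerCosh_sq_sub_one (h₁ : c₁ ^ 2 = s₁ ^ 2 + 1) (h₂ : c₂ ^ 2 = s₂ ^ 2 + 1) :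
    centerCosh γ c₁ s₁ c₂ s₂ ^ 2 - 1
      = (c₁ * s₂ + γ * s₁ * c₂) ^ 2 + (1 - γ ^ 2) * s₁ ^ 2 := by
  unfold centerCosh
  linear_combination (c₁ ^ 2 - γ ^ 2 * s₁ ^ 2) * h₂ + h₁

theorem one_lt_centerCosh (hγ : 0 ≤ γ) (h₁ : c₁ ^ 2 = s₁ ^ 2 + 1) (h₂ : c₂ ^ 2 = s₂ ^ 2 + 1)
    (p₁ : 0 < s₁) (p₂ : 0 < s₂) (q₁ : 0 < c₁) (q₂ : 0 < c₂) :
    1 < centerCosh γ c₁ s₁ c₂ s₂ := by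
  have l₁ : 1 < c₁ := by nlinarith
  have l₂ : 1 < c₂ := by nlinarith
  have : 0 ≤ γ * s₁ * s₂ := by positivity
  unfold centerCosh
  nlinarith

/-- The numerator of the derivative of the angle at vertex `1` in the direction of vertex `2`. -/
theorem angle_deriv_numerator (h₁ : c₁ ^ 2 = s₁ ^ 2 + 1) (h₂ : c₂ ^ 2 = s₂ ^ 2 + 1) {A B G : ℝ}
    (hA : A = centerCosh α c₂ s₂ c₃ s₃) (hB : B = centerCosh β c₁ s₁ c₃ s₃)
    (hG : G = centerCosh γ c₁ s₁ c₂ s₂) :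
    (c₂ * A - c₃) * (G ^ 2 - 1) - (A * G - B) * (c₂ * G - c₁)
      = s₁ * s₂ * ((β + α * γ) * s₃ * (c₁ * s₂ + γ * s₁ * c₂)
          + (1 - γ ^ 2) * s₁ * (s₂ * c₃ + α * c₂ * s₃)) := by
  subst hA hB hG
  unfold centerCosh
  have e₁ : s₁ ^ 2 = c₁ ^ 2 - 1 := by linarith
  have e₂ : s₂ ^ 2 = c₂ ^ 2 - 1 := by linarith
  ring_nf
  simp only [e₁, e₂]
  ring

theorem mul_le_sinh_center (g0 : 0 ≤ γ) (g1 : γ ≤ 1) (h₁ : c₁ ^ 2 = s₁ ^ 2 + 1)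
    (h₂ : c₂ ^ 2 = s₂ ^ 2 + 1) (p₁ : 0 < s₁) (p₂ : 0 < s₂) (q₁ : 0 < c₁) (q₂ : 0 < c₂)
    {g : ℝ} (hg0 : 0 ≤ g) (hg : g ^ 2 = centerCosh γ c₁ s₁ c₂ s₂ ^ 2 - 1) : c₁ * s₂ ≤ g := by
  refine (abs_le_of_sq_le_sq' ?_ hg0).2
  rw [hg, centerCosh_sq_sub_one h₁ h₂]
  have h3 : 0 ≤ γ * s₁ * c₂ := by positivity
  have h4 : 0 ≤ (1 - γ ^ 2) * s₁ ^ 2 := mul_nonneg (by nlinarith) (sq_nonneg _)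
  have h5 : (c₁ * s₂) ^ 2 ≤ (c₁ * s₂ + γ * s₁ * c₂) ^ 2 := by gcongr; linarith
  linarith

-- With N the numerator and D the Gram determinant, the rate is N/(g²√D) and sin θ = √D/(bg), so
-- this is the bound ∂θ/∂u₂ ≤ 4 sin θ cleared of denominators.
set_option maxHeartbeats 1000000 in
theorem angle_deriv_numerator_le (hα : α ∈ Set.Icc (0 : ℝ) 1) (hβ : β ∈ Set.Icc (0 : ℝ) 1)
    (hγ : γ ∈ Set.Icc (0 : ℝ) 1) (h₁ : c₁ ^ 2 = s₁ ^ 2 + 1) (h₂ : c₂ ^ 2 = s₂ ^ 2 + 1)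
    (h₃ : c₃ ^ 2 = s₃ ^ 2 + 1) (p₁ : 0 < s₁) (p₂ : 0 < s₂) (p₃ : 0 < s₃)
    (q₁ : 0 < c₁) (q₂ : 0 < c₂) (q₃ : 0 < c₃) {b g : ℝ} (hg0 : 0 ≤ g)
    (hb : b ^ 2 = centerCosh β c₁ s₁ c₃ s₃ ^ 2 - 1) (hg : g ^ 2 = centerCosh γ c₁ s₁ c₂ s₂ ^ 2 - 1) :
    s₁ * s₂ * ((β + α * γ) * s₃ * (c₁ * s₂ + γ * s₁ * c₂)
          + (1 - γ ^ 2) * s₁ * (s₂ * c₃ + α * c₂ * s₃)) * b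
      ≤ 4 * g * gramDet (centerCosh α c₂ s₂ c₃ s₃) (centerCosh β c₁ s₁ c₃ s₃)
        (centerCosh γ c₁ s₁ c₂ s₂) := by
  have hQ := gramQuad_le hα hβ hγ h₁ h₂ h₃ p₁ p₂ p₃ q₁ q₂ q₃
  obtain ⟨a0, a1⟩ := hα
  obtain ⟨b0, b1⟩ := hβ
  obtain ⟨g0, g1⟩ := hγ
  have l₁ : 1 ≤ c₁ := by nlinarith
  have l₂ : 1 ≤ c₂ := by nlinarith
  have l₃ : 1 ≤ c₃ := by nlinarith
  have A0 : 0 ≤ 1 - α ^ 2 := by nlinarith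
  have B0 : 0 ≤ 1 - β ^ 2 := by nlinarith
  have G0 : 0 ≤ 1 - γ ^ 2 := by nlinarith
  -- The side 13 is at most the sum of the radii r₁ and r₃, whose hyperbolic sine is on the right.
  have hbW : b ≤ s₁ * c₃ + c₁ * s₃ := by
    refine (abs_le_of_sq_le_sq' ?_ (by positivity)).2
    rw [hb, show (s₁ * c₃ + c₁ * s₃) ^ 2 = (c₁ * c₃ + s₁ * s₃) ^ 2 - 1 by
      linear_combination (s₃ ^ 2 - c₃ ^ 2) * h₁ - h₃]
    unfold centerCosh
    have : β * s₁ * s₃ ≤ s₁ * s₃ := by nlinarith [mul_pos p₁ p₃]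
    gcongr
  have hgc : c₁ * s₂ ≤ g := mul_le_sinh_center g0 g1 h₁ h₂ p₁ p₂ q₁ q₂ hg0 hg
  have hgs : s₁ ≤ g := by
    have := mul_le_sinh_center g0 g1 h₂ h₁ p₂ p₁ q₂ q₁ hg0 (by rw [hg, centerCosh_comm])
    nlinarith
  -- The product of N with the bound for `b` expands into eight terms, each at most `g` times terms
  -- of `gramQuad`, by `hgs` and `hgc`. In total no term of `gramQuad` is used more than 5/2 times
  -- (the worst is the one with γ + αβ), and 5/2 · 3/2 ≤ 4.
  have ta : s₁ * s₂ * s₃ * (β + α * γ) * (c₁ * s₂) * (s₁ * c₃)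
      ≤ g * ((β + α * γ) * (c₁ * c₃ * s₁ * s₃ * s₂ ^ 2)) := by
    have := mul_le_mul_of_nonneg_right hgs
      (show 0 ≤ (β + α * γ) * (c₁ * c₃ * s₁ * s₃ * s₂ ^ 2) by positivity)
    linarith
  have tb : s₁ * s₂ * s₃ * (β + α * γ) * (γ * s₁ * c₂) * (s₁ * c₃)
      ≤ g * ((α + β * γ) * (c₂ * c₃ * s₂ * s₃ * s₁ ^ 2)) := by
    have h1 := mul_le_mul_of_nonneg_right hgs
      (show 0 ≤ (α + β * γ) * (c₂ * c₃ * s₂ * s₃ * s₁ ^ 2) by positivity)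
    have h2 : γ * (β + α * γ) ≤ α + β * γ := by nlinarith [mul_nonneg a0 G0]
    have h3 := mul_le_mul_of_nonneg_right h2
      (show 0 ≤ s₁ * (c₂ * c₃ * s₂ * s₃ * s₁ ^ 2) by positivity)
    linarith
  have tc : s₁ * s₂ * s₃ * (β + α * γ) * (c₁ * s₂) * (c₁ * s₃)
      ≤ g * ((1 - α ^ 2) * (c₁ * s₂ * s₃) ^ 2)
        + g * (2 * (γ + α * β) * (c₁ * c₂ * s₁ * s₂ * s₃ ^ 2)) := by
    have h1 : β + α * γ ≤ (1 - α ^ 2) + 2 * (γ + α * β) := by nlinarith [mul_nonneg a0 b0]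
    have h2 := mul_le_mul_of_nonneg_right h1
      (show 0 ≤ s₁ * s₂ * s₃ * (c₁ * s₂) * (c₁ * s₃) by positivity)
    have h3 := mul_le_mul_of_nonneg_right hgs
      (show 0 ≤ (1 - α ^ 2) * (c₁ * s₂ * s₃) ^ 2 by positivity)
    have h4 : s₁ * s₂ * s₃ * (c₁ * s₂) * (c₁ * s₃) ≤ g * (c₁ * c₂ * s₁ * s₂ * s₃ ^ 2) :=
      calc s₁ * s₂ * s₃ * (c₁ * s₂) * (c₁ * s₃) = (c₁ * s₂) * (c₁ * 1 * s₁ * s₂ * s₃ ^ 2) := by ring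
        _ ≤ _ := by gcongr
    have h5 := mul_le_mul_of_nonneg_left h4 (show 0 ≤ 2 * (γ + α * β) by positivity)
    linarith
  have td : s₁ * s₂ * s₃ * (β + α * γ) * (γ * s₁ * c₂) * (c₁ * s₃)
      ≤ g * (2 * (γ + α * β) * (c₁ * c₂ * s₁ * s₂ * s₃ ^ 2)) := by
    have h1 := mul_le_mul_of_nonneg_right hgs
      (show 0 ≤ 2 * (γ + α * β) * (c₁ * c₂ * s₁ * s₂ * s₃ ^ 2) by positivity)
    have h2 : γ * (β + α * γ) ≤ 2 * (γ + α * β) := by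
      nlinarith [mul_nonneg a0 b0, mul_nonneg g0 (sub_nonneg.2 b1), mul_nonneg g0 G0,
        mul_nonneg g0 (sub_nonneg.2 a1), mul_nonneg (mul_nonneg a0 g0) (sub_nonneg.2 g1)]
    have h3 := mul_le_mul_of_nonneg_right h2
      (show 0 ≤ s₁ * (c₁ * c₂ * s₁ * s₂ * s₃ ^ 2) by positivity)
    linarith
  have te : s₁ * s₂ * ((1 - γ ^ 2) * s₁) * (s₂ * c₃) * (s₁ * c₃)
      ≤ g * ((1 - γ ^ 2) * (c₃ * s₁ * s₂) ^ 2) := by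
    have := mul_le_mul_of_nonneg_right hgs
      (show 0 ≤ (1 - γ ^ 2) * (c₃ * s₁ * s₂) ^ 2 by positivity)
    linarith
  have tf : 2 * (s₁ * s₂ * ((1 - γ ^ 2) * s₁) * (s₂ * c₃) * (c₁ * s₃))
      ≤ g * ((1 - α ^ 2) * (c₁ * s₂ * s₃) ^ 2) + g * ((1 - γ ^ 2) * (c₃ * s₁ * s₂) ^ 2)
        + 2 * g * ((α + β * γ) * (c₂ * c₃ * s₂ * s₃ * s₁ ^ 2)) := by
    have h1 : 2 * (s₁ * s₂ * s₁ * (s₂ * c₃) * (c₁ * s₃))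
        ≤ g * ((c₁ * s₂ * s₃) ^ 2 + (c₃ * s₁ * s₂) ^ 2) := by
      have := mul_le_mul_of_nonneg_right hgs
        (show 0 ≤ (c₁ * s₂ * s₃) ^ 2 + (c₃ * s₁ * s₂) ^ 2 by positivity)
      nlinarith [mul_nonneg p₁.le (sq_nonneg (c₁ * s₂ * s₃ - c₃ * s₁ * s₂))]
    have h2 := mul_le_mul_of_nonneg_left h1 (mul_nonneg A0 G0)
    have h3 : s₁ * s₂ * s₁ * (s₂ * c₃) * (c₁ * s₃) ≤ g * (c₂ * c₃ * s₂ * s₃ * s₁ ^ 2) :=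
      calc s₁ * s₂ * s₁ * (s₂ * c₃) * (c₁ * s₃) = (c₁ * s₂) * (1 * c₃ * s₂ * s₃ * s₁ ^ 2) := by ring
        _ ≤ _ := by gcongr
    have h4 := mul_le_mul_of_nonneg_left h3 (show 0 ≤ 2 * (α + β * γ) by positivity)
    have h5 : (1 - γ ^ 2) ≤ (1 - α ^ 2) * (1 - γ ^ 2) + (α + β * γ) := by
      nlinarith [mul_nonneg b0 g0, sq_nonneg (α * γ), mul_nonneg a0 (sub_nonneg.2 a1)]
    have h6 := mul_le_mul_of_nonneg_right h5
      (show 0 ≤ 2 * (s₁ * s₂ * s₁ * (s₂ * c₃) * (c₁ * s₃)) by positivity)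
    have h7 : 0 ≤ g * ((1 - α ^ 2) * γ ^ 2 * (c₁ * s₂ * s₃) ^ 2) := by positivity
    have h8 : 0 ≤ g * (α ^ 2 * (1 - γ ^ 2) * (c₃ * s₁ * s₂) ^ 2) := by positivity
    linarith
  have tg : s₁ * s₂ * ((1 - γ ^ 2) * s₁) * (α * c₂ * s₃) * (s₁ * c₃)
      ≤ g * ((α + β * γ) * (c₂ * c₃ * s₂ * s₃ * s₁ ^ 2)) := by
    have h1 := mul_le_mul_of_nonneg_right hgs
      (show 0 ≤ (α + β * γ) * (c₂ * c₃ * s₂ * s₃ * s₁ ^ 2) by positivity)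
    have h2 : (1 - γ ^ 2) * α ≤ α + β * γ := by
      nlinarith [mul_nonneg b0 g0, mul_nonneg a0 (sq_nonneg γ)]
    have h3 := mul_le_mul_of_nonneg_right h2
      (show 0 ≤ s₁ * (c₂ * c₃ * s₂ * s₃ * s₁ ^ 2) by positivity)
    linarith
  have th : s₁ * s₂ * ((1 - γ ^ 2) * s₁) * (α * c₂ * s₃) * (c₁ * s₃)
      ≤ g * ((1 - β ^ 2) * (c₂ * s₁ * s₃) ^ 2)
        + g * ((γ + α * β) * (c₁ * c₂ * s₁ * s₂ * s₃ ^ 2)) := by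
    have h1 : (1 - γ ^ 2) * α ≤ (1 - β ^ 2) + (γ + α * β) := by
      nlinarith [mul_nonneg a0 (sq_nonneg γ), mul_nonneg b0 (sub_nonneg.2 b1),
        mul_nonneg (sub_nonneg.2 a1) (sub_nonneg.2 b1)]
    have h2 := mul_le_mul_of_nonneg_right h1
      (show 0 ≤ s₁ * s₂ * s₁ * (c₂ * s₃) * (c₁ * s₃) by positivity)
    have h3 : s₁ * s₂ * s₁ * (c₂ * s₃) * (c₁ * s₃) ≤ g * (c₂ * s₁ * s₃) ^ 2 :=
      calc s₁ * s₂ * s₁ * (c₂ * s₃) * (c₁ * s₃) = (c₁ * s₂) * ((1 * s₁ * s₃) * (c₂ * s₁ * s₃)) := by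
            ring
        _ ≤ g * ((c₂ * s₁ * s₃) * (c₂ * s₁ * s₃)) := by gcongr
        _ = _ := by ring
    have h4 := mul_le_mul_of_nonneg_left h3 B0
    have h5 := mul_le_mul_of_nonneg_right hgs
      (show 0 ≤ (γ + α * β) * (c₁ * c₂ * s₁ * s₂ * s₃ ^ 2) by positivity)
    linarith
  have hterm : 0 ≤ g * ((1 - α ^ 2) * (c₁ * s₂ * s₃) ^ 2) ∧
      0 ≤ g * ((1 - β ^ 2) * (c₂ * s₁ * s₃) ^ 2) ∧ 0 ≤ g * ((1 - γ ^ 2) * (c₃ * s₁ * s₂) ^ 2) ∧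
      0 ≤ g * ((γ + α * β) * (c₁ * c₂ * s₁ * s₂ * s₃ ^ 2)) ∧
      0 ≤ g * ((β + α * γ) * (c₁ * c₃ * s₁ * s₃ * s₂ ^ 2)) ∧
      0 ≤ g * ((α + β * γ) * (c₂ * c₃ * s₂ * s₃ * s₁ ^ 2)) :=
    ⟨by positivity, by positivity, by positivity, by positivity, by positivity, by positivity⟩
  obtain ⟨n1, n2, n3, n4, n5, n6⟩ := hterm
  have hN : 0 ≤ s₁ * s₂ * ((β + α * γ) * s₃ * (c₁ * s₂ + γ * s₁ * c₂)
          + (1 - γ ^ 2) * s₁ * (s₂ * c₃ + α * c₂ * s₃)) := by positivity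
  have hQ' := mul_le_mul_of_nonneg_left hQ hg0
  unfold gramQuad at hQ'
  refine (mul_le_mul_of_nonneg_left hbW hN).trans ?_
  have hD : 0 ≤ g * gramDet (centerCosh α c₂ s₂ c₃ s₃) (centerCosh β c₁ s₁ c₃ s₃)
        (centerCosh γ c₁ s₁ c₂ s₂) := by linarith
  linarith

end Algebra

open Real

/-! ### Angles as functions of the conformal factors -/

/-- The hyperbolic cosine of the radius with conformal factor `u`. -/
def coshRadius (u : ℝ) : ℝ := -cosh u / sinh u

/-- The hyperbolic sine of the radius with conformal factor `u`. -/
def sinhRadius (u : ℝ) : ℝ := -1 / sinh u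

/-! ### Hyperbolic functions of the radius in terms of the conformal factor -/

section Radius

variable {u : ℝ}

theorem sinhRadius_pos (hu : u < 0) : 0 < sinhRadius u :=
  div_pos_of_neg_of_neg (by norm_num) (sinh_neg_iff.2 hu)

theorem coshRadius_pos (hu : u < 0) : 0 < coshRadius u :=
  div_pos_of_neg_of_neg (neg_lt_zero.2 (cosh_pos u)) (sinh_neg_iff.2 hu)

theorem coshRadius_sq (hu : u < 0) : coshRadius u ^ 2 = sinhRadius u ^ 2 + 1 := by
  have h : sinh u ≠ 0 := (sinh_neg_iff.2 hu).ne
  unfold coshRadius sinhRadius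
  field_simp
  rw [cosh_sq]; ring

/-- Half-angle substitution: for w = r/2, tanh w = exp u gives cosh² w · (1 - exp 2u) = 1, and cosh
2w becomes -coth u. -/
theorem cosh_radius (hu : u < 0) : cosh (radius u) = coshRadius u := by
  have h1 : exp u < 1 := by simpa using hu
  have h0 : 0 < exp u := exp_pos u
  have ht : tanh (radius u / 2) = exp u := by
    rw [radius, mul_div_cancel_left₀ _ (two_ne_zero), tanh_artanh ⟨by linarith, h1⟩]
  set w := radius u / 2 with hw
  have hr : radius u = 2 * w := by rw [hw]; ring
  have hs : sinh w = exp u * cosh w := by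
    rw [← ht, tanh_eq_sinh_div_cosh, div_mul_cancel₀ _ (cosh_pos w).ne']
  have hsh : sinh u ≠ 0 := (sinh_neg_iff.2 hu).ne
  have h2 : cosh w ^ 2 * (1 - exp u ^ 2) = 1 := by
    have := cosh_sq w
    rw [hs] at this; linarith
  have ec : cosh u = (exp u + (exp u)⁻¹) / 2 := by rw [cosh_eq, exp_neg]
  have es : sinh u = (exp u - (exp u)⁻¹) / 2 := by rw [sinh_eq, exp_neg]
  rw [hr, cosh_two_mul, hs, coshRadius, eq_div_iff hsh, ec, es]
  field_simp
  linear_combination (-(1 + exp u ^ 2)) * h2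

theorem sinh_radius (hu : u < 0) : sinh (radius u) = sinhRadius u := by
  have h1 : exp u < 1 := by simpa using hu
  have hr : 0 ≤ radius u := by
    unfold radius
    have := artanh_nonneg ((exp_pos u).le)
    linarith
  refine (sq_eq_sq₀ (sinh_nonneg_iff.2 hr) (sinhRadius_pos hu).le).1 ?_
  have h2 := cosh_sq (radius u)
  rw [cosh_radius hu, coshRadius_sq hu] at h2
  linarith

/-- This is dr/du = sinh r in disguise. -/
theorem hasDerivAt_coshRadius (hu : u < 0) :
    HasDerivAt coshRadius (sinhRadius u ^ 2) u := by
  have h : sinh u ≠ 0 := (sinh_neg_iff.2 hu).ne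
  refine (((hasDerivAt_cosh u).neg).div (hasDerivAt_sinh u) h).congr_deriv ?_
  unfold sinhRadius
  field_simp
  simp only [Pi.neg_apply]
  nlinarith [cosh_sq u]

theorem hasDerivAt_sinhRadius (hu : u < 0) :
    HasDerivAt sinhRadius (coshRadius u * sinhRadius u) u := by
  have h : sinh u ≠ 0 := (sinh_neg_iff.2 hu).ne
  refine ((hasDerivAt_const u (-1 : ℝ)).div (hasDerivAt_sinh u) h).congr_deriv ?_
  unfold sinhRadius coshRadius
  field_simp
  ring

theorem monotoneOn_coshRadius : MonotoneOn coshRadius (Set.Iio 0) := by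
  refine monotoneOn_of_deriv_nonneg (convex_Iio 0)
    (fun x hx => (hasDerivAt_coshRadius hx).continuousAt.continuousWithinAt) ?_ ?_
  · rw [interior_Iio]
    exact fun x hx => (hasDerivAt_coshRadius hx).differentiableAt.differentiableWithinAt
  · rw [interior_Iio]
    intro x hx
    rw [(hasDerivAt_coshRadius hx).deriv]
    positivity

theorem tendsto_coshRadius : Filter.Tendsto coshRadius (nhdsWithin 0 (Set.Iio 0)) Filter.atTop := by
  have h1 : Filter.Tendsto (fun u : ℝ => -sinh u) (nhdsWithin 0 (Set.Iio 0))
      (nhdsWithin 0 (Set.Ioi 0)) := by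
    refine tendsto_nhdsWithin_iff.2 ⟨?_, ?_⟩
    · have : Filter.Tendsto (fun u : ℝ => -sinh u) (nhds 0) (nhds (-sinh 0)) :=
        continuous_sinh.neg.tendsto 0
      rw [sinh_zero, neg_zero] at this
      exact this.mono_left nhdsWithin_le_nhds
    · filter_upwards [self_mem_nhdsWithin] with x hx
      simpa using hx
  refine Filter.tendsto_atTop_mono' _ ?_ (tendsto_inv_nhdsGT_zero.comp h1)
  filter_upwards [self_mem_nhdsWithin] with x hx
  have hs : 0 < -sinh x := neg_pos.2 (sinh_neg_iff.2 hx)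
  simp only [Function.comp, coshRadius]
  rw [inv_eq_one_div, neg_div, ← div_neg]
  gcongr
  exact one_le_cosh x

theorem contDiffAt_coshRadius {n : WithTop ℕ∞} (hu : u < 0) : ContDiffAt ℝ n coshRadius u :=
  contDiff_cosh.neg.contDiffAt.div contDiff_sinh.contDiffAt (sinh_neg_iff.2 hu).ne

theorem contDiffAt_sinhRadius {n : WithTop ℕ∞} (hu : u < 0) : ContDiffAt ℝ n sinhRadius u :=
  contDiffAt_const.div contDiff_sinh.contDiffAt (sinh_neg_iff.2 hu).ne

end Radius

/-- The hyperbolic cosine of the length of an edge, as a function of the conformal factors of its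
vertices and the cosine `φ` of the intersection angle. -/
def edgeCosh (φ x y : ℝ) : ℝ :=
  centerCosh φ (coshRadius x) (sinhRadius x) (coshRadius y) (sinhRadius y)

/-- The cosine of the angle opposite to the side of length `a`, in the triangle with sides
`a`, `b`, `c`, as a function of the hyperbolic cosines `A`, `B`, `G` of `a`, `b`, `c`. -/
def cosAngle (A B G : ℝ) : ℝ := (B * G - A) / (√(B ^ 2 - 1) * √(G ^ 2 - 1))

/-- The angle at the first vertex of the triangle with conformal factors `x`, `y`, `z`, where
`α`, `β`, `γ` are the cosines of the intersection angles at the opposite edges. -/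
def angle (α β γ x y z : ℝ) : ℝ :=
  arccos (cosAngle (edgeCosh α y z) (edgeCosh β x z) (edgeCosh γ x y))

theorem edgeCosh_comm (φ x y : ℝ) : edgeCosh φ x y = edgeCosh φ y x := centerCosh_comm ..

theorem one_lt_edgeCosh {φ x y : ℝ} (hφ : 0 ≤ φ) (hx : x < 0) (hy : y < 0) :
    1 < edgeCosh φ x y :=
  one_lt_centerCosh hφ (coshRadius_sq hx) (coshRadius_sq hy) (sinhRadius_pos hx)
    (sinhRadius_pos hy) (coshRadius_pos hx) (coshRadius_pos hy)

theorem sinhRadius_le_coshRadius {x : ℝ} (hx : x < 0) : sinhRadius x ≤ coshRadius x :=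
  (abs_le_of_sq_le_sq' (by have := coshRadius_sq hx; linarith) (coshRadius_pos hx).le).2

theorem edgeCosh_le {φ x y : ℝ} (hφ : φ ≤ 1) (hx : x < 0) (hy : y < 0) :
    edgeCosh φ x y ≤ 2 * (coshRadius x * coshRadius y) := by
  have h1 := mul_le_mul (sinhRadius_le_coshRadius hx) (sinhRadius_le_coshRadius hy)
    (sinhRadius_pos hy).le (coshRadius_pos hx).le
  have h2 := mul_le_mul_of_nonneg_right hφ (mul_pos (sinhRadius_pos hx) (sinhRadius_pos hy)).le
  unfold edgeCosh centerCosh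
  linarith

theorem le_edgeCosh {φ x y : ℝ} (hφ : 0 ≤ φ) (hx : x < 0) (hy : y < 0) :
    coshRadius x * coshRadius y ≤ edgeCosh φ x y := by
  have h2 := mul_nonneg hφ (mul_pos (sinhRadius_pos hx) (sinhRadius_pos hy)).le
  unfold edgeCosh centerCosh
  linarith

theorem gramDet_edgeCosh_pos {α β γ x y z : ℝ} (hα : α ∈ Set.Icc (0 : ℝ) 1)
    (hβ : β ∈ Set.Icc (0 : ℝ) 1) (hγ : γ ∈ Set.Icc (0 : ℝ) 1) (hx : x < 0) (hy : y < 0)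
    (hz : z < 0) : 0 < gramDet (edgeCosh α y z) (edgeCosh β x z) (edgeCosh γ x y) := by
  refine lt_of_lt_of_le ?_ (gramDet_lower hα hβ hγ (coshRadius_sq hx) (coshRadius_sq hy)
    (coshRadius_sq hz) (sinhRadius_pos hx) (sinhRadius_pos hy) (sinhRadius_pos hz)
    (coshRadius_pos hx) (coshRadius_pos hy) (coshRadius_pos hz))
  have := sinhRadius_pos hx
  have := sinhRadius_pos hy
  have := sinhRadius_pos hz
  positivity

/-- The chain rule gives s₁(s₁c₂ + φc₁s₂); rewriting it through the edge itself removes φ, so that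
the angle derivatives become rational in edges and radii, up to √D. -/
theorem hasDerivAt_edgeCosh {φ s x' y' : ℝ} {x y : ℝ → ℝ} (hx : HasDerivAt x x' s)
    (hy : HasDerivAt y y' s) (hx0 : x s < 0) (hy0 : y s < 0) :
    HasDerivAt (fun t => edgeCosh φ (x t) (y t))
      ((coshRadius (x s) * edgeCosh φ (x s) (y s) - coshRadius (y s)) * x'
        + (coshRadius (y s) * edgeCosh φ (x s) (y s) - coshRadius (x s)) * y') s := by
  have c₁ := (hasDerivAt_coshRadius hx0).comp s hx
  have s₁ := (hasDerivAt_sinhRadius hx0).comp s hx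
  have c₂ := (hasDerivAt_coshRadius hy0).comp s hy
  have s₂ := (hasDerivAt_sinhRadius hy0).comp s hy
  have h := (c₁.mul c₂).add ((s₁.const_mul φ).mul s₂)
  refine h.congr_deriv ?_
  have e₁ := coshRadius_sq hx0
  have e₂ := coshRadius_sq hy0
  simp only [Function.comp, edgeCosh, centerCosh]
  linear_combination (-(coshRadius (y s) * x')) * e₁ - (coshRadius (x s) * y') * e₂

theorem one_sub_cosAngle_sq {A B G : ℝ} (hB : 1 < B) (hG : 1 < G) :
    1 - cosAngle A B G ^ 2 = gramDet A B G / ((B ^ 2 - 1) * (G ^ 2 - 1)) := by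
  have b0 : 0 < B ^ 2 - 1 := by nlinarith
  have g0 : 0 < G ^ 2 - 1 := by nlinarith
  unfold cosAngle gramDet
  rw [div_pow, mul_pow, sq_sqrt b0.le, sq_sqrt g0.le]
  field_simp
  ring

theorem sqrt_one_sub_cosAngle_sq {A B G : ℝ} (hB : 1 < B) (hG : 1 < G) :
    √(1 - cosAngle A B G ^ 2) = √(gramDet A B G) / (√(B ^ 2 - 1) * √(G ^ 2 - 1)) := by
  have b0 : 0 < B ^ 2 - 1 := by nlinarith
  have g0 : 0 < G ^ 2 - 1 := by nlinarith
  rw [one_sub_cosAngle_sq hB hG, sqrt_div' _ (mul_pos b0 g0).le, sqrt_mul b0.le]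

theorem cosAngle_mem_Ioo {A B G : ℝ} (hB : 1 < B) (hG : 1 < G) (hD : 0 < gramDet A B G) :
    cosAngle A B G ∈ Set.Ioo (-1 : ℝ) 1 := by
  have b0 : 0 < B ^ 2 - 1 := by nlinarith
  have g0 : 0 < G ^ 2 - 1 := by nlinarith
  have h : 0 < 1 - cosAngle A B G ^ 2 := by
    rw [one_sub_cosAngle_sq hB hG]; positivity
  exact abs_lt.1 ((sq_lt_one_iff_abs_lt_one _).1 (by linarith))

theorem hasDerivAt_arccos_cosAngle {A B G : ℝ → ℝ} {A' B' G' s : ℝ} (hA : HasDerivAt A A' s)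
    (hB : HasDerivAt B B' s) (hG : HasDerivAt G G' s) (hB1 : 1 < B s) (hG1 : 1 < G s)
    (hD : 0 < gramDet (A s) (B s) (G s)) :
    HasDerivAt (fun t => arccos (cosAngle (A t) (B t) (G t)))
      ((A' - (A s * B s - G s) / (B s ^ 2 - 1) * B' - (A s * G s - B s) / (G s ^ 2 - 1) * G')
        / √(gramDet (A s) (B s) (G s))) s := by
  have b0 : 0 < B s ^ 2 - 1 := by nlinarith
  have g0 : 0 < G s ^ 2 - 1 := by nlinarith
  have hq := cosAngle_mem_Ioo hB1 hG1 hD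
  have hsb := ((hB.pow 2).sub_const 1).sqrt b0.ne'
  have hsg := ((hG.pow 2).sub_const 1).sqrt g0.ne'
  have pb := sqrt_pos.2 b0
  have pg := sqrt_pos.2 g0
  have pd := sqrt_pos.2 hD
  have hdiv := ((hB.mul hG).sub hA).div (hsb.mul hsg) (mul_pos pb pg).ne'
  have h := (hasDerivAt_arccos hq.1.ne' hq.2.ne).comp s hdiv
  refine h.congr_deriv ?_
  rw [sqrt_one_sub_cosAngle_sq hB1 hG1]
  have eb := sq_sqrt b0.le
  have eg := sq_sqrt g0.le
  simp only [Pi.mul_apply, Pi.sub_apply, Pi.pow_apply]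
  set b := √(B s ^ 2 - 1)
  set g := √(G s ^ 2 - 1)
  rw [← eb, ← eg]
  field_simp
  have eb' : B s ^ 2 = b ^ 2 + 1 := by linarith
  have eg' : G s ^ 2 = g ^ 2 + 1 := by linarith
  ring_nf
  simp only [eb', eg']
  ring

/-- The partial derivative of `angle` with respect to the second conformal factor. -/
def angleRate (α β γ x y z : ℝ) : ℝ :=
  (coshRadius y * edgeCosh α y z - coshRadius z
    - (edgeCosh α y z * edgeCosh γ x y - edgeCosh β x z) / (edgeCosh γ x y ^ 2 - 1)
      * (coshRadius y * edgeCosh γ x y - coshRadius x))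
    / √(gramDet (edgeCosh α y z) (edgeCosh β x z) (edgeCosh γ x y))

theorem gramDet_swap (A B G : ℝ) : gramDet A G B = gramDet A B G := by
  unfold gramDet; ring

theorem cosAngle_swap (A B G : ℝ) : cosAngle A G B = cosAngle A B G := by
  unfold cosAngle; rw [mul_comm G B, mul_comm √(G ^ 2 - 1)]

theorem angle_swap (α β γ x y z : ℝ) : angle α γ β x z y = angle α β γ x y z := by
  unfold angle; rw [edgeCosh_comm α z y, cosAngle_swap]

theorem angle_nonneg (α β γ x y z : ℝ) : 0 ≤ angle α β γ x y z := arccos_nonneg _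

theorem angle_le_pi (α β γ x y z : ℝ) : angle α β γ x y z ≤ π := arccos_le_pi _

/-! ### Derivatives, bounds and smoothness of a single angle -/

section Angle

variable {α β γ : ℝ}

/-- The derivative in the own variable is minus the combination of the other two with coefficients
`edgeCosh` > 1. This diagonal dominance drives the comparison estimates. -/
theorem hasDerivAt_angle (hα : α ∈ Set.Icc (0 : ℝ) 1) (hβ : β ∈ Set.Icc (0 : ℝ) 1)
    (hγ : γ ∈ Set.Icc (0 : ℝ) 1) {x y z : ℝ → ℝ} {x' y' z' s : ℝ} (hx : HasDerivAt x x' s)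
    (hy : HasDerivAt y y' s) (hz : HasDerivAt z z' s) (hx0 : x s < 0) (hy0 : y s < 0)
    (hz0 : z s < 0) :
    HasDerivAt (fun t => angle α β γ (x t) (y t) (z t))
      (angleRate α β γ (x s) (y s) (z s) * (y' - edgeCosh γ (x s) (y s) * x')
        + angleRate α γ β (x s) (z s) (y s) * (z' - edgeCosh β (x s) (z s) * x')) s := by
  have hB1 := one_lt_edgeCosh hβ.1 hx0 hz0
  have hG1 := one_lt_edgeCosh hγ.1 hx0 hy0
  have hD := gramDet_edgeCosh_pos hα hβ hγ hx0 hy0 hz0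
  have h := hasDerivAt_arccos_cosAngle (hasDerivAt_edgeCosh (φ := α) hy hz hy0 hz0)
    (hasDerivAt_edgeCosh (φ := β) hx hz hx0 hz0) (hasDerivAt_edgeCosh (φ := γ) hx hy hx0 hy0)
    hB1 hG1 hD
  refine h.congr_deriv ?_
  have pd := sqrt_pos.2 hD
  unfold angleRate
  rw [edgeCosh_comm α (z s) (y s), gramDet_swap]
  have b0 : edgeCosh β (x s) (z s) ^ 2 - 1 ≠ 0 := by nlinarith
  have g0 : edgeCosh γ (x s) (y s) ^ 2 - 1 ≠ 0 := by nlinarith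
  field_simp
  ring

theorem angleRate_mul (hα : α ∈ Set.Icc (0 : ℝ) 1) (hβ : β ∈ Set.Icc (0 : ℝ) 1)
    (hγ : γ ∈ Set.Icc (0 : ℝ) 1) {x y z : ℝ} (hx : x < 0) (hy : y < 0) (hz : z < 0) :
    angleRate α β γ x y z * ((edgeCosh γ x y ^ 2 - 1)
        * √(gramDet (edgeCosh α y z) (edgeCosh β x z) (edgeCosh γ x y))) =
      sinhRadius x * sinhRadius y * ((β + α * γ) * sinhRadius z
        * (coshRadius x * sinhRadius y + γ * sinhRadius x * coshRadius y)
        + (1 - γ ^ 2) * sinhRadius x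
          * (sinhRadius y * coshRadius z + α * coshRadius y * sinhRadius z)) := by
  rw [← angle_deriv_numerator (coshRadius_sq hx) (coshRadius_sq hy) (A := edgeCosh α y z)
    (B := edgeCosh β x z) (G := edgeCosh γ x y) rfl rfl rfl]
  have hG1 := one_lt_edgeCosh hγ.1 hx hy
  have g0 : edgeCosh γ x y ^ 2 - 1 ≠ 0 := by nlinarith
  have pd := sqrt_pos.2 (gramDet_edgeCosh_pos hα hβ hγ hx hy hz)
  unfold angleRate
  field_simp

theorem angleRate_nonneg (hα : α ∈ Set.Icc (0 : ℝ) 1) (hβ : β ∈ Set.Icc (0 : ℝ) 1)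
    (hγ : γ ∈ Set.Icc (0 : ℝ) 1) {x y z : ℝ} (hx : x < 0) (hy : y < 0) (hz : z < 0) :
    0 ≤ angleRate α β γ x y z := by
  have h := angleRate_mul hα hβ hγ hx hy hz
  have hG1 := one_lt_edgeCosh hγ.1 hx hy
  have g0 : 0 < edgeCosh γ x y ^ 2 - 1 := by nlinarith
  have pd := sqrt_pos.2 (gramDet_edgeCosh_pos hα hβ hγ hx hy hz)
  refine nonneg_of_mul_nonneg_left ?_ (mul_pos g0 pd)
  rw [h]
  have := sinhRadius_pos hx
  have := sinhRadius_pos hy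
  have := sinhRadius_pos hz
  have := coshRadius_pos hx
  have := coshRadius_pos hy
  have := coshRadius_pos hz
  have := hα.1
  have := hβ.1
  have := hγ.1
  have : 0 ≤ 1 - γ ^ 2 := by nlinarith [hγ.2]
  positivity

/-- `angle_deriv_numerator_le` and sin θ ≤ θ. A bound by the angle itself, not by a constant, is
what survives summation over arbitrarily many triangles. -/
theorem angleRate_le (hα : α ∈ Set.Icc (0 : ℝ) 1) (hβ : β ∈ Set.Icc (0 : ℝ) 1)
    (hγ : γ ∈ Set.Icc (0 : ℝ) 1) {x y z : ℝ} (hx : x < 0) (hy : y < 0) (hz : z < 0) :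
    angleRate α β γ x y z ≤ 4 * angle α β γ x y z := by
  have h := angleRate_mul hα hβ hγ hx hy hz
  have hB1 := one_lt_edgeCosh hβ.1 hx hz
  have hG1 := one_lt_edgeCosh hγ.1 hx hy
  have b0 : 0 < edgeCosh β x z ^ 2 - 1 := by nlinarith
  have g0 : 0 < edgeCosh γ x y ^ 2 - 1 := by nlinarith
  have hD := gramDet_edgeCosh_pos hα hβ hγ hx hy hz
  have hle := angle_deriv_numerator_le hα hβ hγ (coshRadius_sq hx) (coshRadius_sq hy)
    (coshRadius_sq hz) (sinhRadius_pos hx) (sinhRadius_pos hy) (sinhRadius_pos hz)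
    (coshRadius_pos hx) (coshRadius_pos hy) (coshRadius_pos hz)
    (sqrt_nonneg _) (sq_sqrt b0.le) (sq_sqrt g0.le)
  rw [← h] at hle
  change _ ≤ 4 * √(edgeCosh γ x y ^ 2 - 1)
    * gramDet (edgeCosh α y z) (edgeCosh β x z) (edgeCosh γ x y) at hle
  change angleRate α β γ x y z * ((edgeCosh γ x y ^ 2 - 1) * _) * √(edgeCosh β x z ^ 2 - 1)
    ≤ _ at hle
  have hsin : √(gramDet (edgeCosh α y z) (edgeCosh β x z) (edgeCosh γ x y))
      / (√(edgeCosh β x z ^ 2 - 1) * √(edgeCosh γ x y ^ 2 - 1)) ≤ angle α β γ x y z := by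
    rw [← sqrt_one_sub_cosAngle_sq hB1 hG1, ← sin_arccos]
    exact sin_le (angle_nonneg ..)
  refine le_trans ?_ (mul_le_mul_of_nonneg_left hsin (by norm_num))
  have pb := sqrt_pos.2 b0
  have pg := sqrt_pos.2 g0
  have pd := sqrt_pos.2 hD
  have eg := sq_sqrt g0.le
  have ed := sq_sqrt hD.le
  set b := √(edgeCosh β x z ^ 2 - 1)
  set g := √(edgeCosh γ x y ^ 2 - 1)
  set d := √(gramDet (edgeCosh α y z) (edgeCosh β x z) (edgeCosh γ x y))
  rw [← eg, ← ed] at hle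
  rw [← mul_div_assoc, le_div_iff₀ (mul_pos pb pg)]
  have hgd : 0 < g * d := mul_pos pg pd
  refine le_of_mul_le_mul_right ?_ hgd
  linarith

/-- Angles are small at large circles, uniformly in the other two radii. -/
theorem angle_le_arccos (hα : α ∈ Set.Icc (0 : ℝ) 1) (hβ : β ∈ Set.Icc (0 : ℝ) 1)
    (hγ : γ ∈ Set.Icc (0 : ℝ) 1) {x y z : ℝ} (hx : x < 0) (hy : y < 0) (hz : z < 0)
    (hc : 2 ≤ coshRadius x ^ 2) :
    angle α β γ x y z ≤ arccos (1 - 2 / coshRadius x ^ 2) := by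
  refine arccos_le_arccos ?_
  have hB1 := one_lt_edgeCosh hβ.1 hx hz
  have hG1 := one_lt_edgeCosh hγ.1 hx hy
  have hA1 := one_lt_edgeCosh hα.1 hy hz
  have b0 : 0 < edgeCosh β x z ^ 2 - 1 := by nlinarith
  have g0 : 0 < edgeCosh γ x y ^ 2 - 1 := by nlinarith
  have hA := edgeCosh_le hα.2 hy hz
  have hB := le_edgeCosh hβ.1 hx hz
  have hG := le_edgeCosh hγ.1 hx hy
  have hcx := coshRadius_pos hx
  have hcyz : 0 < coshRadius y * coshRadius z := mul_pos (coshRadius_pos hy) (coshRadius_pos hz)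
  have hBG : coshRadius x ^ 2 * (coshRadius y * coshRadius z) ≤ edgeCosh β x z * edgeCosh γ x y := by
    have := mul_le_mul hB hG (mul_pos hcx (coshRadius_pos hy)).le (by linarith)
    linarith
  have hb : √(edgeCosh β x z ^ 2 - 1) ≤ edgeCosh β x z :=
    sqrt_le_iff.2 ⟨by linarith, by linarith⟩
  have hg : √(edgeCosh γ x y ^ 2 - 1) ≤ edgeCosh γ x y :=
    sqrt_le_iff.2 ⟨by linarith, by linarith⟩
  have pb := sqrt_pos.2 b0
  have pg := sqrt_pos.2 g0
  -- The upper bound for the opposite edge and the lower bounds for the adjacent ones contain the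
  -- same factor in `y`, `z`, which cancels.
  have hnum : (1 - 2 / coshRadius x ^ 2) * (edgeCosh β x z * edgeCosh γ x y)
      ≤ edgeCosh β x z * edgeCosh γ x y - edgeCosh α y z := by
    have : edgeCosh α y z ≤ 2 / coshRadius x ^ 2 * (edgeCosh β x z * edgeCosh γ x y) := by
      calc edgeCosh α y z ≤ 2 * (coshRadius y * coshRadius z) := hA
        _ = 2 / coshRadius x ^ 2 * (coshRadius x ^ 2 * (coshRadius y * coshRadius z)) := by
          field_simp
        _ ≤ _ := by gcongr
    linarith
  -- The sign allows the hyperbolic sines in the denominator to be replaced by the larger cosines.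
  have h1 : 0 ≤ 1 - 2 / coshRadius x ^ 2 := by
    rw [sub_nonneg, div_le_one (by positivity)]; exact hc
  unfold cosAngle
  rw [le_div_iff₀ (mul_pos pb pg)]
  refine le_trans ?_ hnum
  gcongr

theorem contDiffAt_angle {n : WithTop ℕ∞} (hα : α ∈ Set.Icc (0 : ℝ) 1)
    (hβ : β ∈ Set.Icc (0 : ℝ) 1) (hγ : γ ∈ Set.Icc (0 : ℝ) 1) {p : ℝ × ℝ × ℝ} (hx : p.1 < 0)
    (hy : p.2.1 < 0) (hz : p.2.2 < 0) :
    ContDiffAt ℝ n (fun p : ℝ × ℝ × ℝ => angle α β γ p.1 p.2.1 p.2.2) p := by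
  have hB1 := one_lt_edgeCosh hβ.1 hx hz
  have hG1 := one_lt_edgeCosh hγ.1 hx hy
  have hD := gramDet_edgeCosh_pos hα hβ hγ hx hy hz
  have b0 : 0 < edgeCosh β p.1 p.2.2 ^ 2 - 1 := by nlinarith
  have g0 : 0 < edgeCosh γ p.1 p.2.1 ^ 2 - 1 := by nlinarith
  have hq := cosAngle_mem_Ioo hB1 hG1 hD
  have p1 : ContDiffAt ℝ n (fun p : ℝ × ℝ × ℝ => p.1) p := contDiffAt_fst
  have p2 : ContDiffAt ℝ n (fun p : ℝ × ℝ × ℝ => p.2.1) p := by fun_prop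
  have p3 : ContDiffAt ℝ n (fun p : ℝ × ℝ × ℝ => p.2.2) p := by fun_prop
  have key : ∀ (φ : ℝ) {f g : ℝ × ℝ × ℝ → ℝ}, ContDiffAt ℝ n f p → ContDiffAt ℝ n g p →
      f p < 0 → g p < 0 → ContDiffAt ℝ n (fun p => edgeCosh φ (f p) (g p)) p := by
    intro φ f g hf hg hf0 hg0
    have c1 := (contDiffAt_coshRadius (n := n) hf0).comp p hf
    have c2 := (contDiffAt_coshRadius (n := n) hg0).comp p hg
    have s1 := (contDiffAt_sinhRadius (n := n) hf0).comp p hf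
    have s2 := (contDiffAt_sinhRadius (n := n) hg0).comp p hg
    exact (c1.mul c2).add ((contDiffAt_const.mul s1).mul s2)
  have kA := key α p2 p3 hy hz
  have kB := key β p1 p3 hx hz
  have kG := key γ p1 p2 hx hy
  have kb := ((kB.pow 2).sub contDiffAt_const).sqrt b0.ne'
  have kg := ((kG.pow 2).sub contDiffAt_const).sqrt g0.ne'
  have kq := ((kB.mul kG).sub kA).div (kb.mul kg) (mul_pos (sqrt_pos.2 b0) (sqrt_pos.2 g0)).ne'
  exact ContDiffAt.comp (g := arccos) p (contDiffAt_arccos hq.1.ne' hq.2.ne) kq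

end Angle

/-- The inner angles of a circle packing metric in terms of the conformal factors. -/
theorem innerAngle_radius {V : Type*} {Φ : Sym2 V → ℝ} {u : V → ℝ} {i j k : V}
    (hjk : 0 ≤ cos (Φ s(j, k))) (hik : 0 ≤ cos (Φ s(i, k))) (hij : 0 ≤ cos (Φ s(i, j)))
    (hi : u i < 0) (hj : u j < 0) (hk : u k < 0) :
    innerAngle Φ (fun v => radius (u v)) i j k =
      angle (cos (Φ s(j, k))) (cos (Φ s(i, k))) (cos (Φ s(i, j))) (u i) (u j) (u k) := by
  have key : ∀ a b : V, u a < 0 → u b < 0 →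
      edgeLength Φ (fun v => radius (u v)) a b = arcosh (edgeCosh (cos (Φ s(a, b))) (u a) (u b)) := by
    intro a b ha hb
    simp only [edgeLength, cosh_radius ha, cosh_radius hb, sinh_radius ha, sinh_radius hb]
    rfl
  have hA1 := (one_lt_edgeCosh hjk hj hk).le
  have hB1 := (one_lt_edgeCosh hik hi hk).le
  have hG1 := (one_lt_edgeCosh hij hi hj).le
  unfold innerAngle hyperbolicAngle angle
  rw [key j k hj hk, key i j hi hj, key i k hi hk, cosh_arcosh hA1, cosh_arcosh hB1,
    cosh_arcosh hG1, sinh_arcosh hB1, sinh_arcosh hG1, ← cosAngle_swap]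
  rfl

/-! ### Comparison of angles and curvatures of two conformal factors -/

theorem le_of_hasDerivAt_nonneg {h h' : ℝ → ℝ}
    (hd : ∀ s ∈ Set.Icc (0 : ℝ) 1, HasDerivAt h (h' s) s)
    (h0 : ∀ s ∈ Set.Icc (0 : ℝ) 1, 0 ≤ h' s) : h 0 ≤ h 1 := by
  refine monotoneOn_of_deriv_nonneg (convex_Icc 0 1)
    (fun x hx => (hd x hx).continuousAt.continuousWithinAt)
    (fun x hx => (hd x (interior_subset hx)).differentiableAt.differentiableWithinAt)
    (fun x hx => ?_) (Set.left_mem_Icc.2 zero_le_one) (Set.right_mem_Icc.2 zero_le_one) zero_le_one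
  rw [(hd x (interior_subset hx)).deriv]
  exact h0 x (interior_subset hx)

theorem hasDerivAt_segment (x x₁ s : ℝ) : HasDerivAt (fun s => x + s * (x₁ - x)) (x₁ - x) s := by
  simpa using ((hasDerivAt_id s).mul_const (x₁ - x)).const_add x

theorem segment_le {x x₁ b s : ℝ} (hx : x ≤ b) (hx₁ : x₁ ≤ b) (hs : s ∈ Set.Icc (0 : ℝ) 1) :
    x + s * (x₁ - x) ≤ b := by
  nlinarith [mul_le_mul_of_nonneg_left hx₁ hs.1,
    mul_le_mul_of_nonneg_left hx (sub_nonneg.2 hs.2)]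

theorem segment_neg {x x₁ s : ℝ} (hx : x < 0) (hx₁ : x₁ < 0) (hs : s ∈ Set.Icc (0 : ℝ) 1) :
    x + s * (x₁ - x) < 0 :=
  (segment_le (le_max_left x x₁) (le_max_right x x₁) hs).trans_lt (max_lt hx hx₁)

section Segment

variable {α β γ x y z x₁ y₁ z₁ : ℝ}

theorem hasDerivAt_angle_segment (hα : α ∈ Set.Icc (0 : ℝ) 1) (hβ : β ∈ Set.Icc (0 : ℝ) 1)
    (hγ : γ ∈ Set.Icc (0 : ℝ) 1) (hx : x < 0) (hy : y < 0) (hz : z < 0) (hx₁ : x₁ < 0)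
    (hy₁ : y₁ < 0) (hz₁ : z₁ < 0) {s : ℝ} (hs : s ∈ Set.Icc (0 : ℝ) 1) :
    ∃ p q : ℝ, 0 ≤ p ∧ 0 ≤ q ∧
      p ≤ 4 * angle α β γ (x + s * (x₁ - x)) (y + s * (y₁ - y)) (z + s * (z₁ - z)) ∧
      q ≤ 4 * angle α β γ (x + s * (x₁ - x)) (y + s * (y₁ - y)) (z + s * (z₁ - z)) ∧
      HasDerivAt (fun s => angle α β γ (x + s * (x₁ - x)) (y + s * (y₁ - y)) (z + s * (z₁ - z)))
        (p * ((y₁ - y) - edgeCosh γ (x + s * (x₁ - x)) (y + s * (y₁ - y)) * (x₁ - x))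
          + q * ((z₁ - z) - edgeCosh β (x + s * (x₁ - x)) (z + s * (z₁ - z)) * (x₁ - x))) s := by
  have hX := segment_neg hx hx₁ hs
  have hY := segment_neg hy hy₁ hs
  have hZ := segment_neg hz hz₁ hs
  refine ⟨_, _, angleRate_nonneg hα hβ hγ hX hY hZ, angleRate_nonneg hα hγ hβ hX hZ hY,
    angleRate_le hα hβ hγ hX hY hZ, ?_, hasDerivAt_angle hα hβ hγ (hasDerivAt_segment x x₁ s)
      (hasDerivAt_segment y y₁ s) (hasDerivAt_segment z z₁ s) hX hY hZ⟩
  exact (angleRate_le hα hγ hβ hX hZ hY).trans_eq (by rw [angle_swap])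

theorem edgeCosh_le_of_le {φ a b : ℝ} (hφ : φ ≤ 1) (hxa : x ≤ a) (hyb : y ≤ b) (ha : a < 0)
    (hb : b < 0) : edgeCosh φ x y ≤ 2 * (coshRadius a * coshRadius b) := by
  have hx := hxa.trans_lt ha
  have hy := hyb.trans_lt hb
  refine (edgeCosh_le hφ hx hy).trans ?_
  have h1 := monotoneOn_coshRadius hx ha hxa
  have h2 := monotoneOn_coshRadius hy hb hyb
  have := coshRadius_pos hy
  have := coshRadius_pos ha
  gcongr

/-- Below (a, b, c), `L` dominates the own-variable derivative: the rates are at most 4π and each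
edge cosine at most twice a product of two `coshRadius`, hence 8π. -/
theorem angle_add_mul_le (hα : α ∈ Set.Icc (0 : ℝ) 1) (hβ : β ∈ Set.Icc (0 : ℝ) 1)
    (hγ : γ ∈ Set.Icc (0 : ℝ) 1) {a b c L : ℝ} (ha : a < 0) (hb : b < 0) (hc : c < 0)
    (hL : 8 * π * (coshRadius a * coshRadius b + coshRadius a * coshRadius c) ≤ L)
    (hx : x ≤ x₁) (hy : y ≤ y₁) (hz : z ≤ z₁) (hx₁ : x₁ ≤ a) (hy₁ : y₁ ≤ b) (hz₁ : z₁ ≤ c) :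
    angle α β γ x y z + L * x ≤ angle α β γ x₁ y₁ z₁ + L * x₁ ∧
      ∀ m, x₁ ≤ x + m → y₁ ≤ y + m → z₁ ≤ z + m →
        angle α β γ x₁ y₁ z₁ + L * x₁ ≤ angle α β γ x y z + L * x + L * m := by
  have key : ∀ s ∈ Set.Icc (0 : ℝ) 1, ∃ p q : ℝ, 0 ≤ p ∧ 0 ≤ q ∧ ∃ B G : ℝ, 1 ≤ B ∧ 1 ≤ G ∧
      p * G + q * B ≤ L ∧
      HasDerivAt (fun s => angle α β γ (x + s * (x₁ - x)) (y + s * (y₁ - y)) (z + s * (z₁ - z)))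
        (p * ((y₁ - y) - G * (x₁ - x)) + q * ((z₁ - z) - B * (x₁ - x))) s := by
    intro s hs
    have hX := segment_le (hx.trans hx₁) hx₁ hs
    have hY := segment_le (hy.trans hy₁) hy₁ hs
    have hZ := segment_le (hz.trans hz₁) hz₁ hs
    obtain ⟨p, q, hp, hq, hp', hq', hd⟩ := hasDerivAt_angle_segment hα hβ hγ
      ((hx.trans hx₁).trans_lt ha) ((hy.trans hy₁).trans_lt hb) ((hz.trans hz₁).trans_lt hc)
      (hx₁.trans_lt ha) (hy₁.trans_lt hb) (hz₁.trans_lt hc) hs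
    have hG1 := (one_lt_edgeCosh hγ.1 (hX.trans_lt ha) (hY.trans_lt hb)).le
    have hB1 := (one_lt_edgeCosh hβ.1 (hX.trans_lt ha) (hZ.trans_lt hc)).le
    refine ⟨p, q, hp, hq, _, _, hB1, hG1, ?_, hd⟩
    have hG2 := edgeCosh_le_of_le hγ.2 hX hY ha hb
    have hB2 := edgeCosh_le_of_le hβ.2 hX hZ ha hc
    have hpi := angle_le_pi α β γ (x + s * (x₁ - x)) (y + s * (y₁ - y)) (z + s * (z₁ - z))
    have h1 := mul_le_mul (hp'.trans (mul_le_mul_of_nonneg_left hpi (by norm_num))) hG2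
      (by linarith) (by positivity)
    have h2 := mul_le_mul (hq'.trans (mul_le_mul_of_nonneg_left hpi (by norm_num))) hB2
      (by linarith) (by positivity)
    linarith
  choose! p q hp hq B G hB hG hpq hd using key
  have hd' : ∀ s ∈ Set.Icc (0 : ℝ) 1, HasDerivAt (fun s => angle α β γ (x + s * (x₁ - x))
      (y + s * (y₁ - y)) (z + s * (z₁ - z)) + L * (x + s * (x₁ - x)))
      (p s * ((y₁ - y) - G s * (x₁ - x)) + q s * ((z₁ - z) - B s * (x₁ - x)) + L * (x₁ - x)) s :=
    fun s hs => (hd s hs).add ((hasDerivAt_segment x x₁ s).const_mul L)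
  constructor
  · have h := le_of_hasDerivAt_nonneg hd' fun s hs => by
      have h1 := mul_le_mul_of_nonneg_right (hpq s hs) (sub_nonneg.2 hx)
      have h2 := mul_nonneg (hp s hs) (sub_nonneg.2 hy)
      have h3 := mul_nonneg (hq s hs) (sub_nonneg.2 hz)
      linarith
    simpa using h
  · intro m hmx hmy hmz
    have h := le_of_hasDerivAt_nonneg
      (fun s hs => ((hasDerivAt_id s).const_mul (L * m)).sub (hd' s hs)) fun s hs => by
        have h1 := mul_le_mul_of_nonneg_right (hpq s hs) (show 0 ≤ m - (x₁ - x) by linarith)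
        have h2 := mul_le_mul_of_nonneg_left (show y₁ - y ≤ m by linarith) (hp s hs)
        have h3 := mul_le_mul_of_nonneg_left (show z₁ - z ≤ m by linarith) (hq s hs)
        have hm : 0 ≤ m := by linarith
        -- Edge cosines are at least 1, so a common shift of the three factors cannot raise the
        -- angle.
        have h4 := mul_nonneg (mul_nonneg (hp s hs) (sub_nonneg.2 (hG s hs))) hm
        have h5 := mul_nonneg (mul_nonneg (hq s hs) (sub_nonneg.2 (hB s hs))) hm
        linarith
    have h' : -(angle α β γ x y z + L * x) ≤ L * m - (angle α β γ x₁ y₁ z₁ + L * x₁) := by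
      simpa using h
    linarith

/-- A Harnack type inequality for angles. -/
theorem angle_le_mul_exp (hα : α ∈ Set.Icc (0 : ℝ) 1) (hβ : β ∈ Set.Icc (0 : ℝ) 1)
    (hγ : γ ∈ Set.Icc (0 : ℝ) 1) (hx : x < 0) (hy : y < 0) (hz : z < 0) (hx₁ : x₁ < 0)
    (hy₁ : y₁ < 0) (hz₁ : z₁ < 0) {m : ℝ} (hm : 0 ≤ m) (hxm : x ≤ x₁) (hym : y₁ - y ≤ m)
    (hzm : z₁ - z ≤ m) :
    angle α β γ x₁ y₁ z₁ ≤ angle α β γ x y z * exp (8 * m) := by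
  have key : ∀ s ∈ Set.Icc (0 : ℝ) 1, ∃ D : ℝ,
      D ≤ 8 * m * angle α β γ (x + s * (x₁ - x)) (y + s * (y₁ - y)) (z + s * (z₁ - z)) ∧
      HasDerivAt (fun s => angle α β γ (x + s * (x₁ - x)) (y + s * (y₁ - y)) (z + s * (z₁ - z)))
        D s := by
    intro s hs
    obtain ⟨p, q, hp, hq, hp', hq', hd⟩ :=
      hasDerivAt_angle_segment hα hβ hγ hx hy hz hx₁ hy₁ hz₁ hs
    refine ⟨_, ?_, hd⟩
    have hX := segment_neg hx hx₁ hs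
    have hG1 := one_lt_edgeCosh hγ.1 hX (segment_neg hy hy₁ hs)
    have hB1 := one_lt_edgeCosh hβ.1 hX (segment_neg hz hz₁ hs)
    -- As x ≤ x₁, the own-variable terms only lower the angle; the others add at most 4m + 4m to its
    -- logarithmic derivative.
    have h1 := mul_nonneg (mul_nonneg hp (by linarith :
      0 ≤ edgeCosh γ (x + s * (x₁ - x)) (y + s * (y₁ - y)))) (sub_nonneg.2 hxm)
    have h2 := mul_nonneg (mul_nonneg hq (by linarith :
      0 ≤ edgeCosh β (x + s * (x₁ - x)) (z + s * (z₁ - z)))) (sub_nonneg.2 hxm)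
    have h3 := mul_le_mul_of_nonneg_left hym hp
    have h4 := mul_le_mul_of_nonneg_left hzm hq
    have h5 := mul_le_mul_of_nonneg_right hp' hm
    have h6 := mul_le_mul_of_nonneg_right hq' hm
    linarith
  choose! D hD hd using key
  have hexp : ∀ s : ℝ, HasDerivAt (fun s => exp (-(8 * m) * s)) (exp (-(8 * m) * s) * (-(8 * m))) s :=
    fun s => by simpa using ((hasDerivAt_id s).const_mul (-(8 * m))).exp
  have h := le_of_hasDerivAt_nonneg (fun s hs => ((hd s hs).mul (hexp s)).neg) fun s hs => by
    have := mul_nonneg (sub_nonneg.2 (hD s hs)) (exp_pos (-(8 * m) * s)).le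
    linarith
  have h' : angle α β γ x₁ y₁ z₁ * exp (-(8 * m)) ≤ angle α β γ x y z := by simpa using h
  calc angle α β γ x₁ y₁ z₁ = angle α β γ x₁ y₁ z₁ * exp (-(8 * m)) * exp (8 * m) := by
        rw [mul_assoc, ← exp_add]; simp
    _ ≤ _ := by gcongr

end Segment

/-! ### From single angles to the curvature at a vertex -/

section Curvature

variable {V : Type*} {T : AbstractSimplicialComplex V} {Φ : Sym2 V → ℝ}

theorem IsFace.mem_edges {i j k : V} (h : IsFace T i j k) :
    s(j, k) ∈ edges T ∧ s(i, k) ∈ edges T ∧ s(i, j) ∈ edges T := by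
  classical
  obtain ⟨hij, hik, hjk, σ, hσ, hs⟩ := h
  have key : ∀ a b : V, a ≠ b → a ∈ ({i, j, k} : Set V) → b ∈ ({i, j, k} : Set V) →
      s(a, b) ∈ edges T := by
    intro a b hab ha hb
    refine ⟨a, b, hab, rfl, {a, b}, ?_, by simp⟩
    refine T.isRelLowerSet_faces.mem_of_le hσ ?_ (Finset.insert_nonempty _ _)
    intro c hc
    rw [← Finset.mem_coe, hs]
    rcases Finset.mem_insert.1 hc with rfl | hc
    · exact ha
    · rw [Finset.mem_singleton.1 hc]; exact hb
  exact ⟨key _ _ hjk (by simp) (by simp), key _ _ hik (by simp) (by simp),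
    key _ _ hij (by simp) (by simp)⟩

theorem cos_mem_Icc (hΦ : ∀ e ∈ edges T, Φ e ∈ Set.Icc 0 (π / 2)) {e : Sym2 V}
    (he : e ∈ edges T) : cos (Φ e) ∈ Set.Icc (0 : ℝ) 1 :=
  ⟨cos_nonneg_of_mem_Icc ⟨by linarith [(hΦ e he).1, pi_pos], (hΦ e he).2⟩, cos_le_one _⟩

theorem innerAngleOpp_eq_angle (hΦ : ∀ e ∈ edges T, Φ e ∈ Set.Icc 0 (π / 2)) {i : V} {e : Sym2 V}
    (he : e ∈ oppositeSides T i) :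
    ∃ (j k : V) (α β γ : ℝ), α ∈ Set.Icc (0 : ℝ) 1 ∧ β ∈ Set.Icc (0 : ℝ) 1 ∧
      γ ∈ Set.Icc (0 : ℝ) 1 ∧ ∀ u : V → ℝ, IsConformalFactor u →
        innerAngleOpp Φ (fun v => radius (u v)) i e = angle α β γ (u i) (u j) (u k) := by
  obtain ⟨j, k, rfl, hf⟩ := he
  obtain ⟨e1, e2, e3⟩ := hf.mem_edges
  have h1 := cos_mem_Icc hΦ e1
  have h2 := cos_mem_Icc hΦ e2
  have h3 := cos_mem_Icc hΦ e3
  exact ⟨j, k, _, _, _, h1, h2, h3, fun u hu =>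
    innerAngle_radius h1.1 h2.1 h3.1 (hu i) (hu j) (hu k)⟩

/-- Near each vertex the curvature is given by finitely many angles of triangles. -/
theorem K_eq_sum_angle (hT : ∀ v : V, {σ : Finset V | σ ∈ T ∧ v ∈ σ}.Finite)
    (hΦ : ∀ e ∈ edges T, Φ e ∈ Set.Icc 0 (π / 2)) (i : V) :
    ∃ (S : Finset (Sym2 V)) (j k : Sym2 V → V) (α β γ : Sym2 V → ℝ), (∀ e ∈ S,
      α e ∈ Set.Icc (0 : ℝ) 1 ∧ β e ∈ Set.Icc (0 : ℝ) 1 ∧ γ e ∈ Set.Icc (0 : ℝ) 1) ∧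
      ∀ u : V → ℝ, IsConformalFactor u →
        K T Φ u i = 2 * π - ∑ e ∈ S, angle (α e) (β e) (γ e) (u i) (u (j e)) (u (k e)) := by
  have hfin := oppositeSides_finite T i (hT i)
  have : Nonempty V := ⟨i⟩
  have hang := fun e (he : e ∈ oppositeSides T i) => innerAngleOpp_eq_angle hΦ he
  choose! j k α β γ h1 h2 h3 h4 using hang
  refine ⟨hfin.toFinset, j, k, α, β, γ, fun e he => ?_, fun u hu => ?_⟩
  · have he' := hfin.mem_toFinset.1 he
    exact ⟨h1 e he', h2 e he', h3 e he'⟩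
  · unfold K curvature
    rw [finsum_mem_eq_finite_toFinset_sum _ hfin]
    congr 1
    exact Finset.sum_congr rfl fun e he => h4 e (hfin.mem_toFinset.1 he) u hu

variable (hT : ∀ v : V, {σ : Finset V | σ ∈ T ∧ v ∈ σ}.Finite)
  (hΦ : ∀ e ∈ edges T, Φ e ∈ Set.Icc 0 (π / 2))

include hT hΦ

theorem K_le_two_pi (i : V) {u : V → ℝ} (hu : IsConformalFactor u) : K T Φ u i ≤ 2 * π := by
  obtain ⟨S, j, k, α, β, γ, -, hK⟩ := K_eq_sum_angle hT hΦ i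
  rw [hK u hu]
  have := Finset.sum_nonneg fun e (_ : e ∈ S) =>
    angle_nonneg (α e) (β e) (γ e) (u i) (u (j e)) (u (k e))
  linarith

theorem contDiffOn_K {n : WithTop ℕ∞} {s : Set ℝ} {u : ℝ → V → ℝ} (i : V)
    (hu : ∀ t ∈ s, IsConformalFactor (u t)) (hd : ∀ v, ContDiffOn ℝ n (fun t => u t v) s) :
    ContDiffOn ℝ n (fun t => K T Φ (u t) i) s := by
  obtain ⟨S, j, k, α, β, γ, hS, hK⟩ := K_eq_sum_angle hT hΦ i
  refine ContDiffOn.congr ?_ fun t ht => hK (u t) (hu t ht)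
  refine contDiffOn_const.sub (ContDiffOn.sum fun e he => ?_)
  obtain ⟨h1, h2, h3⟩ := hS e he
  intro t ht
  have h := contDiffAt_angle (n := n) h1 h2 h3 (p := (u t i, u t (j e), u t (k e))) (hu t ht _)
    (hu t ht _) (hu t ht _)
  exact ContDiffAt.comp_contDiffWithinAt (f := fun t => (u t i, u t (j e), u t (k e))) t h
    ((hd i t ht).prodMk ((hd _ t ht).prodMk (hd _ t ht)))

theorem continuousOn_K (i : V) :
    ContinuousOn (fun u => K T Φ u i) {u : V → ℝ | IsConformalFactor u} := by
  obtain ⟨S, j, k, α, β, γ, hS, hK⟩ := K_eq_sum_angle hT hΦ i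
  refine ContinuousOn.congr ?_ hK
  refine continuousOn_const.sub (continuousOn_finsetSum _ fun e he => ?_)
  obtain ⟨h1, h2, h3⟩ := hS e he
  intro u hu
  have h := (contDiffAt_angle (n := 0) h1 h2 h3 (p := (u i, u (j e), u (k e))) (hu _) (hu _)
    (hu _)).continuousAt
  exact (ContinuousAt.comp (f := fun u : V → ℝ => (u i, u (j e), u (k e))) h
    (by fun_prop)).continuousWithinAt

/-- The first inequality is cooperativity; the second expresses that a common upward shift does not
increase the angle sum. They feed existence and the velocity bound, respectively. -/
theorem K_comparison (i : V) {b : V → ℝ} (hb : IsConformalFactor b) :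
    ∃ L : ℝ, 0 < L ∧ ∀ u v : V → ℝ, u ≤ v → v ≤ b →
      -K T Φ u i + L * u i ≤ -K T Φ v i + L * v i ∧
      ∀ m, (∀ j, v j ≤ u j + m) → -K T Φ v i + L * v i ≤ -K T Φ u i + L * u i + L * m := by
  obtain ⟨S, j, k, α, β, γ, hS, hK⟩ := K_eq_sum_angle hT hΦ i
  set l : Sym2 V → ℝ := fun e => 8 * π * (coshRadius (b i) * coshRadius (b (j e))
    + coshRadius (b i) * coshRadius (b (k e))) with hl
  have hl0 : 0 ≤ ∑ e ∈ S, l e := Finset.sum_nonneg fun e _ => by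
    have := coshRadius_pos (hb i)
    have := coshRadius_pos (hb (j e))
    have := coshRadius_pos (hb (k e))
    positivity
  -- The added 1 ensures positivity even for empty `S`.
  refine ⟨∑ e ∈ S, l e + 1, by linarith, fun u v huv hvb => ?_⟩
  have hv : IsConformalFactor v := fun w => (hvb w).trans_lt (hb w)
  have hu : IsConformalFactor u := fun w => (huv w).trans_lt (hv w)
  have key := fun e (he : e ∈ S) => angle_add_mul_le (hS e he).1 (hS e he).2.1 (hS e he).2.2 (hb i)
    (hb (j e)) (hb (k e)) (le_refl (l e)) (huv i) (huv (j e)) (huv (k e)) (hvb i) (hvb (j e))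
    (hvb (k e))
  rw [hK u hu, hK v hv]
  constructor
  · have h := Finset.sum_le_sum fun e he => (key e he).1
    rw [Finset.sum_add_distrib, Finset.sum_add_distrib, ← Finset.sum_mul, ← Finset.sum_mul] at h
    linarith [huv i]
  · intro m hm
    have h := Finset.sum_le_sum fun e he => (key e he).2 m (hm _) (hm _) (hm _)
    rw [Finset.sum_add_distrib, Finset.sum_add_distrib, Finset.sum_add_distrib, ← Finset.sum_mul,
      ← Finset.sum_mul, ← Finset.sum_mul] at h
    linarith [hm i]

/-- Sum of the Harnack inequalities for the angles; being multiplicative, they give a factor free of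
the number of triangles. -/
theorem two_pi_sub_K_le (i : V) {u v : V → ℝ} (hu : IsConformalFactor u)
    (hv : IsConformalFactor v) {m : ℝ} (hm : 0 ≤ m) (hi : v i ≤ u i) (hle : ∀ j, u j - v j ≤ m) :
    2 * π - K T Φ u i ≤ (2 * π - K T Φ v i) * exp (8 * m) := by
  obtain ⟨S, j, k, α, β, γ, hS, hK⟩ := K_eq_sum_angle hT hΦ i
  rw [hK u hu, hK v hv, sub_sub_cancel, sub_sub_cancel, Finset.sum_mul]
  exact Finset.sum_le_sum fun e he => angle_le_mul_exp (hS e he).1 (hS e he).2.1 (hS e he).2.2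
    (hv _) (hv _) (hv _) (hu _) (hu _) (hu _) hm hi (hle _) (hle _)

/-- The curvature at a vertex is close to `2π` if its circle is large enough. -/
theorem exists_le_K (i : V) {κ a : ℝ} (hκ : κ < 2 * π) (ha : a < 0) :
    ∃ b, a ≤ b ∧ b < 0 ∧ ∀ u : V → ℝ, IsConformalFactor u → b ≤ u i → κ ≤ K T Φ u i := by
  obtain ⟨S, j, k, α, β, γ, hS, hK⟩ := K_eq_sum_angle hT hΦ i
  have hc2 : Filter.Tendsto (fun u => coshRadius u ^ 2) (nhdsWithin 0 (Set.Iio 0)) Filter.atTop :=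
    (Filter.tendsto_pow_atTop two_ne_zero).comp tendsto_coshRadius
  have hlim : Filter.Tendsto (fun u => S.card * arccos (1 - 2 / coshRadius u ^ 2))
      (nhdsWithin 0 (Set.Iio 0)) (nhds 0) := by
    have h1 : Filter.Tendsto (fun u => 1 - 2 / coshRadius u ^ 2) (nhdsWithin 0 (Set.Iio 0))
        (nhds (1 - 0)) := tendsto_const_nhds.sub (hc2.const_div_atTop 2)
    have h2 := (continuous_arccos.tendsto _).comp h1
    have h3 := h2.const_mul (S.card : ℝ)
    simpa using h3
  -- For `b` near 0: the total of the angle bounds is below 2π - κ, `angle_le_arccos` applies, and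
  -- `b` lies above `a`.
  have hev := ((hlim.eventually (gt_mem_nhds (sub_pos.2 hκ))).and
    (hc2.eventually_ge_atTop 2)).and (Ioo_mem_nhdsLT ha)
  obtain ⟨b, ⟨hb1, hb2⟩, hb3⟩ := hev.exists
  refine ⟨b, hb3.1.le, hb3.2, fun u hu hbu => ?_⟩
  have hcb := coshRadius_pos hb3.2
  have hmono := monotoneOn_coshRadius hb3.2 (hu i) hbu
  have hsq : coshRadius b ^ 2 ≤ coshRadius (u i) ^ 2 := by gcongr
  have hle : ∑ e ∈ S, angle (α e) (β e) (γ e) (u i) (u (j e)) (u (k e))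
      ≤ S.card * arccos (1 - 2 / coshRadius b ^ 2) := by
    rw [← nsmul_eq_mul]
    refine Finset.sum_le_card_nsmul _ _ _ fun e he => ?_
    refine (angle_le_arccos (hS e he).1 (hS e he).2.1 (hS e he).2.2 (hu _) (hu _) (hu _)
      (hb2.trans hsq)).trans (arccos_le_arccos ?_)
    gcongr
  rw [hK u hu]
  linarith

end Curvature

open Set Filter Topology

/-! ### Cooperative systems between a sub- and a supersolution -/

/-- The solution of `φ' = -L φ + G` with initial value `x`. -/
def linearSolution (L x : ℝ) (G : ℝ → ℝ) (t : ℝ) : ℝ :=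
  exp (-(L * t)) * (x + ∫ s in (0 : ℝ)..t, exp (L * s) * G s)

theorem linearSolution_zero (L x : ℝ) (G : ℝ → ℝ) : linearSolution L x G 0 = x := by
  simp [linearSolution]

theorem hasDerivAt_linearSolution (L x : ℝ) {G : ℝ → ℝ} (hG : Continuous G) (t : ℝ) :
    HasDerivAt (linearSolution L x G) (-L * linearSolution L x G t + G t) t := by
  have h1 : HasDerivAt (fun t => exp (-(L * t))) (exp (-(L * t)) * (-L)) t := by
    simpa using ((hasDerivAt_id t).const_mul L).neg.exp
  have hc : Continuous fun s => exp (L * s) * G s := by fun_prop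
  have h2 := (hc.integral_hasStrictDerivAt 0 t).hasDerivAt.const_add x
  refine (h1.mul h2).congr_deriv ?_
  have h3 : exp (-(L * t)) * exp (L * t) = 1 := by rw [← exp_add]; simp
  unfold linearSolution
  linear_combination G t * h3

/-- Integrating factor exp(Lt). The comparisons below apply this to differences. -/
theorem nonpos_of_deriv_le {L : ℝ} {χ χ' : ℝ → ℝ} (hd : ∀ t, 0 ≤ t → HasDerivAt χ (χ' t) t)
    (hle : ∀ t, 0 ≤ t → χ' t ≤ -L * χ t) (h0 : χ 0 ≤ 0) {t : ℝ} (ht : 0 ≤ t) : χ t ≤ 0 := by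
  have hexp : ∀ t : ℝ, HasDerivAt (fun t => exp (L * t)) (exp (L * t) * L) t :=
    fun t => by simpa using ((hasDerivAt_id t).const_mul L).exp
  have hd' : ∀ t, 0 ≤ t → HasDerivAt (fun t => exp (L * t) * χ t)
      (exp (L * t) * L * χ t + exp (L * t) * χ' t) t := fun t ht => (hexp t).mul (hd t ht)
  have hanti : AntitoneOn (fun t => exp (L * t) * χ t) (Ici 0) := by
    refine antitoneOn_of_deriv_nonpos (convex_Ici 0)
      (fun x hx => (hd' x hx).continuousAt.continuousWithinAt)
      (fun x hx => (hd' x (interior_subset hx)).differentiableAt.differentiableWithinAt)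
      (fun x hx => ?_)
    have hx := interior_subset hx
    rw [HasDerivAt.deriv (hd' x hx)]
    nlinarith [hle x hx, exp_pos (L * x)]
  have h1 : exp (L * t) * χ t ≤ exp (L * 0) * χ 0 := hanti self_mem_Ici ht ht
  rw [mul_zero, exp_zero, one_mul] at h1
  exact nonpos_of_mul_nonpos_right (h1.trans h0) (exp_pos _)

/-! ### Comparison principles for the scalar linear equation -/

section LinearSolution

variable {L x : ℝ} {G : ℝ → ℝ}

theorem linearSolution_mono {G₁ : ℝ → ℝ} (hG : Continuous G) (hG₁ : Continuous G₁)
    (hle : ∀ t, 0 ≤ t → G t ≤ G₁ t) {t : ℝ} (ht : 0 ≤ t) :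
    linearSolution L x G t ≤ linearSolution L x G₁ t := by
  have h := nonpos_of_deriv_le (L := L) (fun t _ => (hasDerivAt_linearSolution L x hG t).sub
    (hasDerivAt_linearSolution L x hG₁ t)) (fun t ht => by
      have := hle t ht
      simp only [Pi.sub_apply]
      linarith) (by simp [linearSolution_zero]) ht
  simpa using h

theorem linearSolution_le (hG : Continuous G) {b : ℝ} (hx : x ≤ b)
    (hle : ∀ t, 0 ≤ t → G t ≤ L * b) {t : ℝ} (ht : 0 ≤ t) : linearSolution L x G t ≤ b := by
  have h := nonpos_of_deriv_le (L := L) (fun t _ => (hasDerivAt_linearSolution L x hG t).sub_const b)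
    (fun t ht => by
      have := hle t ht
      linarith) (by simpa [linearSolution_zero]) ht
  simpa using h

theorem le_linearSolution (hG : Continuous G) (hle : ∀ t, 0 ≤ t → L * x ≤ G t) {t : ℝ}
    (ht : 0 ≤ t) : x ≤ linearSolution L x G t := by
  have h := nonpos_of_deriv_le (L := L) (fun t _ => (hasDerivAt_linearSolution L x hG t).const_sub x)
    (fun t ht => by
      have := hle t ht
      linarith) (by simp [linearSolution_zero]) ht
  simpa using h

theorem hasDerivAt_linearSolution_shift (hG : Continuous G) (h t : ℝ) :
    HasDerivAt (fun t => linearSolution L x G (t + h))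
      (-L * linearSolution L x G (t + h) + G (t + h)) t :=
  (hasDerivAt_linearSolution L x hG (t + h)).comp_add_const t h

/-- The time shift solves the same equation with a larger source and a larger initial value. -/
theorem linearSolution_le_shift (hG : Continuous G) (h0 : L * x ≤ G 0)
    (hmono : ∀ t h, 0 ≤ t → 0 ≤ h → G t ≤ G (t + h)) {t h : ℝ} (ht : 0 ≤ t) (hh : 0 ≤ h) :
    linearSolution L x G t ≤ linearSolution L x G (t + h) := by
  have hx : x ≤ linearSolution L x G h :=
    le_linearSolution hG (fun t ht => h0.trans (by simpa using hmono 0 t le_rfl ht)) hh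
  have h := nonpos_of_deriv_le (L := L) (fun t _ => (hasDerivAt_linearSolution L x hG t).sub
    (hasDerivAt_linearSolution_shift (L := L) (x := x) hG h t)) (fun t ht => by
      have := hmono t h ht hh
      simp only [Pi.sub_apply]
      linarith) (by simpa [linearSolution_zero] using hx) ht
  simpa using h

/-- Compare first with the line x + Mt, to control the shift at time 0, then the shifted solution
with the original one raised by Mh. -/
theorem linearSolution_shift_le (hG : Continuous G) {M : ℝ}
    (h0 : G 0 ≤ L * x + M)
    (hlip : ∀ t h, 0 ≤ t → 0 ≤ h → G (t + h) ≤ G t + L * (M * h)) {t h : ℝ} (ht : 0 ≤ t)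
    (hh : 0 ≤ h) : linearSolution L x G (t + h) ≤ linearSolution L x G t + M * h := by
  have hx : linearSolution L x G h ≤ x + M * h := by
    have h := nonpos_of_deriv_le (L := L) (fun t _ => (hasDerivAt_linearSolution L x hG t).sub
      (((hasDerivAt_id t).const_mul M).const_add x)) (fun t ht => by
        have := hlip 0 t le_rfl ht
        rw [zero_add] at this
        simp only [Pi.sub_apply, id]
        linarith) (by simp [linearSolution_zero]) hh
    simpa using h
  have h := nonpos_of_deriv_le (L := L) (fun t _ => ((hasDerivAt_linearSolution_shift (L := L) (x := x) hG h t).sub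
    (hasDerivAt_linearSolution L x hG t)).sub_const (M * h)) (fun t ht => by
      have := hlip t h ht hh
      simp only [Pi.sub_apply]
      linarith) (by
      simp only [Pi.sub_apply, zero_add, linearSolution_zero]
      linarith) ht
  simp only [Pi.sub_apply] at h
  linarith

end LinearSolution

/-! ### Monotone iteration -/

section Cooperative

variable {V : Type*} {f : (V → ℝ) → V → ℝ} {a b L : V → ℝ}

/-- One step of the monotone iteration for `u' = f u`, `u 0 = a`. -/
def monotoneStep (f : (V → ℝ) → V → ℝ) (a L : V → ℝ) (u : ℝ → V → ℝ) (t : ℝ) (i : V) : ℝ :=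
  -- Freezing negative times at the initial value keeps curves monotone and inside [a, b] on all of
  -- ℝ.
  linearSolution (L i) (a i) (fun s => f (u s) i + L i * u s i) (max t 0)

/-- The curves among which the monotone iteration takes place. -/
structure IsIterationCurve (a b : V → ℝ) (u : ℝ → V → ℝ) : Prop where
  mem : ∀ t, u t ∈ Icc a b
  continuous : Continuous u
  monotone : Monotone u

/-- The hypotheses on the vector field: it is continuous and cooperative on the order interval
`[a, b]`, where `a` is a subsolution and `b` a supersolution. -/
structure IsCooperativeOn (f : (V → ℝ) → V → ℝ) (a b L : V → ℝ) : Prop where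
  le : a ≤ b
  pos : ∀ i, 0 < L i
  continuousOn : ∀ i, ContinuousOn (fun u => f u i) (Icc a b)
  mono : ∀ i u v, a ≤ u → u ≤ v → v ≤ b → f u i + L i * u i ≤ f v i + L i * v i
  sub : ∀ i, 0 ≤ f a i
  super : ∀ i, f b i ≤ 0

theorem IsCooperativeOn.continuous_comp (hf : IsCooperativeOn f a b L) {u : ℝ → V → ℝ}
    (hu : IsIterationCurve a b u) (i : V) : Continuous fun s => f (u s) i + L i * u s i :=
  ((hf.continuousOn i).comp_continuous hu.continuous hu.mem).add
    (continuous_const.mul ((continuous_apply i).comp hu.continuous))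

theorem IsCooperativeOn.isIterationCurve_step (hf : IsCooperativeOn f a b L) {u : ℝ → V → ℝ}
    (hu : IsIterationCurve a b u) : IsIterationCurve a b (monotoneStep f a L u) := by
  have hc := hf.continuous_comp hu
  have hlow : ∀ i t, L i * a i ≤ f (u t) i + L i * u t i := fun i t => by
    have h1 := hf.mono i a (u t) le_rfl (hu.mem t).1 (hu.mem t).2
    have h2 := hf.sub i
    linarith
  refine ⟨fun t => ⟨fun i => ?_, fun i => ?_⟩, ?_, fun t t' htt' i => ?_⟩
  · exact le_linearSolution (hc i) (fun t _ => hlow i t) (le_max_right _ _)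
  · refine linearSolution_le (hc i) (hf.le i) (fun t _ => ?_) (le_max_right _ _)
    have h1 := hf.mono i (u t) b (hu.mem t).1 (hu.mem t).2 le_rfl
    have h2 := hf.super i
    linarith
  · refine continuous_pi fun i => ?_
    have h : Continuous (linearSolution (L i) (a i) fun s => f (u s) i + L i * u s i) :=
      continuous_iff_continuousAt.2 fun t => (hasDerivAt_linearSolution _ _ (hc i) t).continuousAt
    exact h.comp (continuous_id.max continuous_const)
  · have h := linearSolution_le_shift (x := a i) (hc i) (hlow i 0) (fun t h _ hh =>
      hf.mono i (u t) (u (t + h)) (hu.mem t).1 (hu.monotone (by linarith)) (hu.mem _).2)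
      (le_max_right t 0) (sub_nonneg.2 (max_le_max_right 0 htt'))
    rwa [add_sub_cancel] at h

theorem IsCooperativeOn.step_mono (hf : IsCooperativeOn f a b L) {u v : ℝ → V → ℝ}
    (hu : IsIterationCurve a b u) (hv : IsIterationCurve a b v) (huv : u ≤ v) :
    monotoneStep f a L u ≤ monotoneStep f a L v := fun t i =>
  linearSolution_mono (hf.continuous_comp hu i) (hf.continuous_comp hv i)
    (fun t _ => hf.mono i (u t) (v t) (hu.mem t).1 (huv t) (hv.mem t).2) (le_max_right t 0)

/-- The monotone iteration, starting from the subsolution. -/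
def monotoneIterate (f : (V → ℝ) → V → ℝ) (a L : V → ℝ) (n : ℕ) : ℝ → V → ℝ :=
  (monotoneStep f a L)^[n] fun _ => a

theorem monotoneIterate_succ (f : (V → ℝ) → V → ℝ) (a L : V → ℝ) (n : ℕ) :
    monotoneIterate f a L (n + 1) = monotoneStep f a L (monotoneIterate f a L n) :=
  Function.iterate_succ_apply' ..

theorem IsCooperativeOn.isIterationCurve (hf : IsCooperativeOn f a b L) (n : ℕ) :
    IsIterationCurve a b (monotoneIterate f a L n) := by
  induction n with
  | zero => exact ⟨fun _ => ⟨le_rfl, hf.le⟩, continuous_const, monotone_const⟩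
  | succ n ih => rw [monotoneIterate_succ]; exact hf.isIterationCurve_step ih

theorem IsCooperativeOn.monotone_iterate (hf : IsCooperativeOn f a b L) :
    Monotone (monotoneIterate f a L) := by
  refine monotone_nat_of_le_succ fun n => ?_
  induction n with
  | zero => exact fun t => ((hf.isIterationCurve 1).mem t).1
  | succ n ih =>
    rw [monotoneIterate_succ, monotoneIterate_succ]
    exact hf.step_mono (hf.isIterationCurve n) (monotoneIterate_succ f a L n ▸
      hf.isIterationCurve (n + 1)) (monotoneIterate_succ f a L n ▸ ih)

/-- If one iterate rises by at most Mh in time h, `hsub` lets the next source rise by at most LMh,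
which is the input of `linearSolution_shift_le`. -/
theorem IsCooperativeOn.iterate_shift_le (hf : IsCooperativeOn f a b L)
    (hsub : ∀ i u v m, a ≤ u → u ≤ v → v ≤ b → (∀ j, v j ≤ u j + m) →
      f v i + L i * v i ≤ f u i + L i * u i + L i * m) {M : ℝ} (hM : 0 ≤ M)
    (ha : ∀ i, f a i ≤ M) (n : ℕ) {t h : ℝ} (ht : 0 ≤ t) (hh : 0 ≤ h) (i : V) :
    monotoneIterate f a L n (t + h) i ≤ monotoneIterate f a L n t i + M * h := by
  induction n generalizing t h i with
  | zero => simpa [monotoneIterate] using mul_nonneg hM hh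
  | succ n ih =>
    have hu := hf.isIterationCurve n
    have h0 : monotoneIterate f a L n 0 = a := by
      cases n with
      | zero => rfl
      | succ n => funext j; simp [monotoneIterate_succ, monotoneStep, linearSolution_zero]
    rw [monotoneIterate_succ]
    simp only [monotoneStep]
    rw [max_eq_left ht, max_eq_left (add_nonneg ht hh)]
    refine linearSolution_shift_le (hf.continuous_comp hu i) ?_ ?_ ht hh
    · rw [h0]; linarith [ha i]
    · intro t h ht hh
      exact hsub i _ _ _ (hu.mem t).1 (hu.monotone (by linarith)) (hu.mem _).2 fun j => ih ht hh j

theorem IsCooperativeOn.exists_limit (hf : IsCooperativeOn f a b L) :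
    ∃ U : ℝ → V → ℝ, ∀ t, Tendsto (fun n => monotoneIterate f a L n t) atTop (𝓝 (U t)) := by
  refine ⟨fun t i => ⨆ n, monotoneIterate f a L n t i, fun t => tendsto_pi_nhds.2 fun i => ?_⟩
  refine tendsto_atTop_ciSup (fun n m hnm => hf.monotone_iterate hnm t i) ⟨b i, ?_⟩
  rintro _ ⟨n, rfl⟩
  exact ((hf.isIterationCurve n).mem t).2 i

theorem IsCooperativeOn.linearSolution_limit (hf : IsCooperativeOn f a b L) {U : ℝ → V → ℝ}
    (hU : ∀ t, Tendsto (fun n => monotoneIterate f a L n t) atTop (𝓝 (U t))) :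
    (∀ t i, U t i = monotoneStep f a L U t i) ∧ Continuous U := by
  have hmem : ∀ t, U t ∈ Icc a b := fun t => isClosed_Icc.mem_of_tendsto (hU t)
    (Eventually.of_forall fun n => (hf.isIterationCurve n).mem t)
  have hGlim : ∀ i s, Tendsto (fun n => f (monotoneIterate f a L n s) i
      + L i * monotoneIterate f a L n s i) atTop (𝓝 (f (U s) i + L i * U s i)) := by
    intro i s
    have h1 : Tendsto (fun n => f (monotoneIterate f a L n s) i) atTop (𝓝 (f (U s) i)) :=
      Tendsto.comp (hf.continuousOn i (U s) (hmem s)) (tendsto_nhdsWithin_iff.2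
        ⟨hU s, Eventually.of_forall fun n => (hf.isIterationCurve n).mem s⟩)
    exact h1.add ((tendsto_pi_nhds.1 (hU s) i).const_mul _)
  -- Monotonicity puts the extreme values at `a` and `b`, giving a domination independent of the
  -- iterate.
  have hbound : ∀ i w, w ∈ Icc a b → ‖f w i + L i * w i‖ ≤
      max |f a i + L i * a i| |f b i + L i * b i| := fun i w hw =>
    abs_le_max_abs_abs (hf.mono i a w le_rfl hw.1 hw.2) (hf.mono i w b hw.1 hw.2 le_rfl)
  have hexp : ∀ i, Continuous fun s => exp (L i * s)
      * max |f a i + L i * a i| |f b i + L i * b i| := fun i => by fun_prop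
  have hnorm : ∀ i s w, w ∈ Icc a b → ‖exp (L i * s) * (f w i + L i * w i)‖ ≤ exp (L i * s)
      * max |f a i + L i * a i| |f b i + L i * b i| := fun i s w hw => by
    rw [norm_mul, norm_of_nonneg (exp_pos _).le]
    exact mul_le_mul_of_nonneg_left (hbound i w hw) (exp_pos _).le
  have hcont : ∀ i n, Continuous fun s => exp (L i * s) * (f (monotoneIterate f a L n s) i
      + L i * monotoneIterate f a L n s i) := fun i n => by
    have := hf.continuous_comp (hf.isIterationCurve n) i
    fun_prop
  have hfix : ∀ t i, U t i = monotoneStep f a L U t i := by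
    intro t i
    have h1 := (tendsto_pi_nhds.1 (hU t) i).comp (tendsto_add_atTop_nat 1)
    refine tendsto_nhds_unique h1 ?_
    simp only [Function.comp_def, monotoneIterate_succ, monotoneStep, linearSolution]
    refine (Tendsto.const_add (a i) ?_).const_mul _
    refine intervalIntegral.tendsto_integral_filter_of_dominated_convergence _
      (Eventually.of_forall fun n => (hcont i n).aestronglyMeasurable)
      (Eventually.of_forall fun n => Eventually.of_forall fun s _ =>
        hnorm i s _ ((hf.isIterationCurve n).mem s)) ((hexp i).intervalIntegrable _ _)
      (Eventually.of_forall fun s _ => (hGlim i s).const_mul _)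
  refine ⟨hfix, continuous_pi fun i => ?_⟩
  -- Continuity of `U` is not yet known: the integrand is measurable as a limit, and the fixed point
  -- formula then makes `U` continuous.
  have hmeas : MeasureTheory.AEStronglyMeasurable (fun s => exp (L i * s) *
      (f (U s) i + L i * U s i)) MeasureTheory.volume :=
    aestronglyMeasurable_of_tendsto_ae atTop (fun n => (hcont i n).aestronglyMeasurable)
      (Eventually.of_forall fun s => (hGlim i s).const_mul _)
  have hint : ∀ c d : ℝ, IntervalIntegrable (fun s => exp (L i * s) * (f (U s) i + L i * U s i))
      MeasureTheory.volume c d := fun c d =>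
    ((hexp i).intervalIntegrable c d).mono_fun' hmeas.restrict
      (Eventually.of_forall fun s => hnorm i s _ (hmem s))
  have hprim := intervalIntegral.continuous_primitive hint 0
  have : Continuous (linearSolution (L i) (a i) fun s => f (U s) i + L i * U s i) := by
    unfold linearSolution
    fun_prop
  simp only [hfix _ i]
  exact this.comp (continuous_id.max continuous_const)

/-- A cooperative system on an order interval between a sub- and a supersolution has a solution
which starts at the subsolution and is monotone. If the system is also subhomogeneous with respect
to translations, then the velocity along this solution is at most its supremum at the start. -/
theorem IsCooperativeOn.exists_solution (hf : IsCooperativeOn f a b L) :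
    ∃ U : ℝ → V → ℝ, U 0 = a ∧ (∀ t, U t ∈ Icc a b) ∧ Monotone U ∧
      (∀ t, 0 ≤ t → ∀ i, HasDerivWithinAt (fun s => U s i) (f (U t) i) (Ici 0) t) ∧
      ((∀ i u v m, a ≤ u → u ≤ v → v ≤ b → (∀ j, v j ≤ u j + m) →
          f v i + L i * v i ≤ f u i + L i * u i + L i * m) →
        ∀ M, 0 ≤ M → (∀ i, f a i ≤ M) → ∀ t, 0 ≤ t → ∀ i, f (U t) i ≤ M) := by
  obtain ⟨U, hU⟩ := hf.exists_limit
  obtain ⟨hfix, hcont⟩ := hf.linearSolution_limit hU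
  have hmem : ∀ t, U t ∈ Icc a b := fun t => isClosed_Icc.mem_of_tendsto (hU t)
    (Eventually.of_forall fun n => (hf.isIterationCurve n).mem t)
  have hmono : Monotone U := fun s t hst => le_of_tendsto_of_tendsto' (hU s) (hU t)
    fun n => (hf.isIterationCurve n).monotone hst
  have hc := hf.continuous_comp ⟨hmem, hcont, hmono⟩
  have hderiv : ∀ t, 0 ≤ t → ∀ i, HasDerivWithinAt (fun s => U s i) (f (U t) i) (Ici 0) t := by
    intro t ht i
    have heq : ∀ s ∈ Ici (0 : ℝ), U s i
        = linearSolution (L i) (a i) (fun s => f (U s) i + L i * U s i) s := fun s hs => by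
      rw [hfix s i, monotoneStep, max_eq_left hs]
    refine ((hasDerivAt_linearSolution (L i) (a i) (hc i) t).hasDerivWithinAt.congr heq
      (heq t ht)).congr_deriv ?_
    rw [← heq t ht]; ring
  refine ⟨U, ?_, hmem, hmono, hderiv, fun hsub M hM ha t ht i => ?_⟩
  · funext i
    simp [hfix 0 i, monotoneStep, linearSolution_zero]
  · have hshift : ∀ t h, 0 ≤ t → 0 ≤ h → U (t + h) i ≤ U t i + M * h := fun t h ht hh =>
      le_of_tendsto_of_tendsto' (tendsto_pi_nhds.1 (hU (t + h)) i)
        ((tendsto_pi_nhds.1 (hU t) i).add_const _)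
        fun n => hf.iterate_shift_le hsub hM ha n ht hh i
    have hmon : MonotoneOn (fun s => M * s - U s i) (Ici 0) := by
      intro s hs r _ hsr
      have := hshift s (r - s) hs (sub_nonneg.2 hsr)
      rw [add_sub_cancel] at this
      simp only
      linarith
    have hd : HasDerivWithinAt (fun s => M * s - U s i) (M * 1 - f (U t) i) (Ici 0) t :=
      ((hasDerivWithinAt_id t _).const_mul M).sub (hderiv t ht i)
    have h0 := hmon.derivWithin_nonneg (x := t)
    rw [hd.derivWithin (uniqueDiffOn_Ici 0 t ht)] at h0
    linarith

end Cooperative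

/-- If a function and its derivative converge at infinity, then the derivative tends to `0`. -/
theorem eq_zero_of_tendsto_deriv {φ φ' : ℝ → ℝ} {l c : ℝ}
    (hd : ∀ t, 0 ≤ t → HasDerivWithinAt φ (φ' t) (Ici 0) t) (hφ : Tendsto φ atTop (𝓝 l))
    (hφ' : Tendsto φ' atTop (𝓝 c)) : c = 0 := by
  -- The mean value theorem on [n, n + 1] samples the derivative at points going to infinity.
  have hmvt : ∀ n : ℕ, ∃ ξ : ℝ, (n : ℝ) ≤ ξ ∧ φ' ξ = φ (n + 1) - φ n := by
    intro n
    have hn : (0 : ℝ) ≤ n := n.cast_nonneg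
    obtain ⟨ξ, hξ, h⟩ := exists_hasDerivAt_eq_slope φ φ' (lt_add_one (n : ℝ))
      (fun t ht => ((hd t (hn.trans ht.1)).continuousWithinAt).mono fun s hs => hn.trans hs.1)
      (fun t ht => (hd t (hn.trans ht.1.le)).hasDerivAt (Ici_mem_nhds (hn.trans_lt ht.1)))
    exact ⟨ξ, hξ.1.le, by rw [h]; simp⟩
  choose ξ hξ hξ' using hmvt
  have h1 : Tendsto (fun n => φ' (ξ n)) atTop (𝓝 c) :=
    hφ'.comp (tendsto_atTop_mono hξ tendsto_natCast_atTop_atTop)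
  have h2 : Tendsto (fun n : ℕ => φ (n + 1) - φ n) atTop (𝓝 (l - l)) :=
    (hφ.comp (tendsto_atTop_add_const_right _ 1 tendsto_natCast_atTop_atTop)).sub
      (hφ.comp tendsto_natCast_atTop_atTop)
  simp only [hξ'] at h1
  rw [sub_self] at h2
  exact tendsto_nhds_unique h1 h2

/-! ### Regularity and uniqueness of the flow -/

section Flow

variable {V : Type*} {T : AbstractSimplicialComplex V} {Φ : Sym2 V → ℝ} {Khat : V → ℝ}
  (hT : ∀ v : V, {σ : Finset V | σ ∈ T ∧ v ∈ σ}.Finite)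
  (hΦ : ∀ e ∈ edges T, Φ e ∈ Set.Icc 0 (π / 2))

include hT hΦ

/-- Bootstrap: if all coordinates are Cⁿ, so is the right-hand side of the equation. -/
theorem IsFlowSolution.contDiffOn {u : ℝ → V → ℝ} (hu : IsFlowSolution T Φ Khat u) (n : ℕ) (i : V) :
    ContDiffOn ℝ n (fun t => u t i) (Ici 0) := by
  induction n generalizing i with
  | zero =>
    exact contDiffOn_zero.2 fun t ht => (hu.flow t ht i).continuousWithinAt
  | succ n ih =>
    push_cast
    refine (contDiffOn_succ_iff_derivWithin (uniqueDiffOn_Ici 0)).2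
      ⟨fun t ht => (hu.flow t ht i).differentiableWithinAt, by simp, ?_⟩
    refine ContDiffOn.congr ?_ fun t ht => (hu.flow t ht i).derivWithin (uniqueDiffOn_Ici 0 t ht)
    exact ((contDiffOn_K hT hΦ i hu.conformal ih).sub contDiffOn_const).neg

theorem IsFlowSolution.isSmoothInTime {u : ℝ → V → ℝ} (hu : IsFlowSolution T Φ Khat u) :
    IsSmoothInTime u :=
  fun i => contDiffOn_infty.2 fun n => hu.contDiffOn hT hΦ n i

theorem IsFlowSolution.isSmoothInTime_K {u : ℝ → V → ℝ} (hu : IsFlowSolution T Φ Khat u) :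
    IsSmoothInTime fun t => K T Φ (u t) :=
  fun i => contDiffOn_K hT hΦ i hu.conformal (hu.isSmoothInTime hT hΦ)

/-- Linearization of the Harnack inequality; the cap `m₀` on `m` controls the exponential. -/
theorem K_sub_K_le {u v : V → ℝ} (hu : IsConformalFactor u) (hv : IsConformalFactor v) {C m m₀ : ℝ}
    {i : V} (hC : |K T Φ v i| ≤ C) (hm : 0 ≤ m) (hm₀ : m ≤ m₀) (hi : v i ≤ u i)
    (hle : ∀ j, u j - v j ≤ m) :
    K T Φ v i - K T Φ u i ≤ 8 * (2 * π + C) * exp (8 * m₀) * m := by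
  have h1 := two_pi_sub_K_le hT hΦ i hu hv hm hi hle
  have h2 : exp (8 * m) - 1 ≤ 8 * m * exp (8 * m₀) := by
    have h3 : 1 - 8 * m ≤ exp (-(8 * m)) := by linarith [add_one_le_exp (-(8 * m))]
    have h4 : exp (8 * m) * exp (-(8 * m)) = 1 := by rw [← exp_add]; simp
    have h5 := mul_le_mul_of_nonneg_left h3 (exp_pos (8 * m)).le
    have h6 : exp (8 * m) ≤ exp (8 * m₀) := exp_le_exp.2 (by linarith)
    nlinarith
  have h3 : 0 ≤ exp (8 * m) - 1 := by linarith [add_one_le_exp (8 * m)]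
  have h4 := (abs_le.1 hC).1
  have h5 : 0 ≤ C := (abs_nonneg _).trans hC
  have h6 := mul_le_mul (show 2 * π - K T Φ v i ≤ 2 * π + C by linarith) h2 h3
    (by linarith [pi_pos])
  linarith

omit hT hΦ in
theorem IsFlowSolution.hasDerivWithinAt_sub {u v : ℝ → V → ℝ} (hu : IsFlowSolution T Φ Khat u)
    (hv : IsFlowSolution T Φ Khat v) {t : ℝ} (ht : 0 ≤ t) (i : V) :
    HasDerivWithinAt (fun s => u s i - v s i) (K T Φ (v t) i - K T Φ (u t) i) (Ici 0) t :=
  ((hu.flow t ht i).sub (hv.flow t ht i)).congr_deriv (by ring)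

/-- A supremum over `V` need not be attained, so each vertex gets the barrier (M/2)exp(4Λt). Its
slope 2ΛM exp(4Λt) beats the velocity bound ΛM exp(4Λt) coming from the weaker estimate. -/
theorem IsFlowSolution.sub_le_half {u v : ℝ → V → ℝ} (hu : IsFlowSolution T Φ Khat u)
    (hv : IsFlowSolution T Φ Khat v) (h0 : u 0 = v 0) {C m₀ M t₀ : ℝ}
    (hC : ∀ t, 0 ≤ t → ∀ i, |K T Φ (v t) i| ≤ C) (hC0 : 0 ≤ C) (hM : 0 < M) (hm₀ : 0 ≤ m₀)
    (hbd : ∀ t ∈ Icc 0 t₀, ∀ i, u t i - v t i ≤ m₀)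
    (hle : ∀ t ∈ Icc 0 t₀, ∀ i,
      u t i - v t i ≤ M * exp (4 * (8 * (2 * π + C) * exp (8 * m₀)) * t)) :
    ∀ t ∈ Icc 0 t₀, ∀ i,
      u t i - v t i ≤ M / 2 * exp (4 * (8 * (2 * π + C) * exp (8 * m₀)) * t) := by
  intro t ht i
  set Λ := 8 * (2 * π + C) * exp (8 * m₀) with hΛ
  have hΛ0 : 0 < Λ := by have := pi_pos; positivity
  have hB : ∀ x : ℝ, HasDerivAt (fun t => M / 2 * exp (4 * Λ * t))
      (M / 2 * (exp (4 * Λ * x) * (4 * Λ))) x := fun x => by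
    simpa using (((hasDerivAt_id x).const_mul (4 * Λ)).exp).const_mul (M / 2)
  refine image_le_of_deriv_right_lt_deriv_boundary (f := fun t => u t i - v t i)
    (f' := fun t => K T Φ (v t) i - K T Φ (u t) i) (a := 0) (b := t₀)
    (fun x hx => (hu.hasDerivWithinAt_sub hv hx.1 i).continuousWithinAt.mono fun y hy => hy.1)
    (fun x hx => (hu.hasDerivWithinAt_sub hv hx.1 i).mono fun y hy => hx.1.trans hy) ?_ hB ?_ ht
  · simp only [h0, sub_self]
    positivity
  · intro x hx hxB
    have hpos : 0 < exp (4 * Λ * x) := exp_pos _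
    have hxI : x ∈ Icc 0 t₀ := ⟨hx.1, hx.2.le⟩
    -- Velocities are compared only where the difference meets the positive barrier, so the
    -- one-sided estimate suffices.
    have hi : v x i ≤ u x i := by
      have : 0 ≤ M / 2 * exp (4 * Λ * x) := by positivity
      linarith
    have h := K_sub_K_le hT hΦ (hu.conformal x hx.1) (hv.conformal x hx.1) (hC x hx.1 i)
      (m := min m₀ (M * exp (4 * Λ * x))) (m₀ := m₀) (le_min hm₀ (by positivity)) (min_le_left _ _)
      hi fun j => le_min (hbd x hxI j) (hle x hxI j)
    refine (h.trans (mul_le_mul_of_nonneg_left (min_le_right _ _) hΛ0.le)).trans_lt ?_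
    have : 0 < Λ * (M * exp (4 * Λ * x)) := by positivity
    linarith

/-- Solutions of the flow with bounded curvature are determined by their initial values. -/
theorem IsFlowSolution.eq_of_bounded {u v : ℝ → V → ℝ} (hu : IsFlowSolution T Φ Khat u)
    (hv : IsFlowSolution T Φ Khat v) (h0 : u 0 = v 0) (hbu : HasBoundedCurvature T Φ u)
    (hbv : HasBoundedCurvature T Φ v) {t : ℝ} (ht : 0 ≤ t) : u t = v t := by
  obtain ⟨C₁, hC₁⟩ := hbu
  obtain ⟨C₂, hC₂⟩ := hbv
  set C := max 0 (max C₁ C₂) with hC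
  have hC0 : 0 ≤ C := le_max_left _ _
  have hCu : ∀ t, 0 ≤ t → ∀ i, |K T Φ (u t) i| ≤ C := fun t ht i =>
    (hC₁ t ht i).trans ((le_max_left _ _).trans (le_max_right _ _))
  have hCv : ∀ t, 0 ≤ t → ∀ i, |K T Φ (v t) i| ≤ C := fun t ht i =>
    (hC₂ t ht i).trans ((le_max_right _ _).trans (le_max_right _ _))
  -- The difference has speed at most 2C at every vertex; the extra 1 keeps `m₀` positive.
  have hlin : ∀ s ∈ Icc 0 t, ∀ i, |u s i - v s i| ≤ 2 * C * t + 1 := by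
    intro s hs i
    have h := (convex_Ici (0 : ℝ)).norm_image_sub_le_of_norm_hasDerivWithin_le (C := 2 * C)
      (fun x hx => hu.hasDerivWithinAt_sub hv hx i) (fun x hx => by
        rw [norm_eq_abs]
        refine (abs_sub _ _).trans ?_
        linarith [hCu x hx i, hCv x hx i]) self_mem_Ici (show s ∈ Ici (0 : ℝ) from hs.1)
    simp only [h0, sub_self, sub_zero, norm_eq_abs] at h
    rw [abs_of_nonneg hs.1] at h
    have := mul_le_mul_of_nonneg_left hs.2 (show 0 ≤ 2 * C by linarith)
    linarith
  set m₀ := 2 * C * t + 1 with hm₀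
  have hm₀0 : 0 < m₀ := by positivity
  set l := 4 * (8 * (2 * π + C) * exp (8 * m₀)) with hl
  have hl0 : 0 ≤ l := by have := pi_pos; positivity
  have key : ∀ n : ℕ, ∀ s ∈ Icc 0 t, ∀ i, |u s i - v s i| ≤ m₀ * (1 / 2) ^ n * exp (l * s) := by
    intro n
    induction n with
    | zero =>
      intro s hs i
      have : 1 ≤ exp (l * s) := one_le_exp (mul_nonneg hl0 hs.1)
      have h1 := hlin s hs i
      rw [pow_zero, mul_one]
      nlinarith
    | succ n ih =>
      intro s hs i
      have hM : 0 < m₀ * (1 / 2) ^ n := by positivity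
      have h1 := hu.sub_le_half hT hΦ hv h0 hCv hC0 hM hm₀0.le
        (fun t ht i => (le_abs_self _).trans (hlin t ht i))
        (fun t ht i => (le_abs_self _).trans (ih t ht i)) s hs i
      have h2 := hv.sub_le_half hT hΦ hu h0.symm hCu hC0 hM hm₀0.le
        (fun t ht i => (le_abs_self _).trans ((abs_sub_comm _ _).trans_le (hlin t ht i)))
        (fun t ht i => (le_abs_self _).trans ((abs_sub_comm _ _).trans_le (ih t ht i))) s hs i
      rw [show m₀ * (1 / 2) ^ (n + 1) = m₀ * (1 / 2) ^ n / 2 by ring]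
      exact abs_le.2 ⟨by linarith, h1⟩
  funext i
  have hlim : Tendsto (fun n : ℕ => m₀ * (1 / 2 : ℝ) ^ n * exp (l * t)) atTop
      (𝓝 (m₀ * 0 * exp (l * t))) :=
    ((tendsto_pow_atTop_nhds_zero_of_lt_one (by norm_num) (by norm_num)).const_mul _).mul_const _
  have h := ge_of_tendsto' hlim fun n => key n t ⟨ht, le_rfl⟩ i
  rw [mul_zero, zero_mul] at h
  exact sub_eq_zero.1 (abs_eq_zero.1 (le_antisymm h (abs_nonneg _)))

/-- The flow starting at a metric whose curvature is below the prescribed one. -/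
theorem exists_flowSolution (hKhat : ∀ i, Khat i < 2 * π) {u₀ : V → ℝ}
    (hu₀ : IsConformalFactor u₀) (hle : ∀ i, K T Φ u₀ i ≤ Khat i) :
    ∃ u : ℝ → V → ℝ, IsFlowSolution T Φ Khat u ∧ u 0 = u₀ ∧
      (∃ uLim : V → ℝ, IsConformalFactor uLim ∧
        (∀ i, Tendsto (fun t => u t i) atTop (𝓝 (uLim i))) ∧ ∀ i, K T Φ uLim i = Khat i) ∧
      ∀ M, 0 ≤ M → (∀ i, Khat i - K T Φ u₀ i ≤ M) →
        ∀ t, 0 ≤ t → ∀ i, Khat i - K T Φ (u t) i ≤ M := by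
  -- The choices at different vertices are independent, since the threshold ignores the neighbouring
  -- radii.
  choose b hab hb hbK using fun i => exists_le_K hT hΦ i (hKhat i) (hu₀ i)
  have hbc : IsConformalFactor b := hb
  choose L hL hcmp using fun i => K_comparison hT hΦ i hbc
  have hbox : ∀ u ∈ Icc u₀ b, IsConformalFactor u := fun u hu i => (hu.2 i).trans_lt (hb i)
  have hf : IsCooperativeOn (fun u i => Khat i - K T Φ u i) u₀ b L :=
    { le := hab
      pos := hL
      continuousOn := fun i => continuousOn_const.sub ((continuousOn_K hT hΦ i).mono hbox)
      mono := fun i u v _ huv hvb => by linarith [(hcmp i u v huv hvb).1]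
      sub := fun i => sub_nonneg.2 (hle i)
      super := fun i => sub_nonpos.2 (hbK i b hbc le_rfl) }
  obtain ⟨u, h0, hmem, hmono, hderiv, hM⟩ := hf.exists_solution
  refine ⟨u, ⟨fun t _ => hbox _ (hmem t), fun t ht i => ?_⟩, h0, ?_, ?_⟩
  · exact (hderiv t ht i).congr_deriv (by ring)
  · have hlim : ∀ i, Tendsto (fun t => u t i) atTop (𝓝 (⨆ t, u t i)) := fun i =>
      tendsto_atTop_ciSup (fun s t hst => hmono hst i)
        ⟨b i, by rintro _ ⟨t, rfl⟩; exact (hmem t).2 i⟩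
    have hlim' : Tendsto u atTop (𝓝 fun i => ⨆ t, u t i) := tendsto_pi_nhds.2 hlim
    have hmemL : (fun i => ⨆ t, u t i) ∈ Icc u₀ b :=
      isClosed_Icc.mem_of_tendsto hlim' (Eventually.of_forall hmem)
    refine ⟨_, hbox _ hmemL, hlim, fun i => ?_⟩
    have hd := (hf.continuousOn i _ hmemL).tendsto.comp
      (tendsto_nhdsWithin_iff.2 ⟨hlim', Eventually.of_forall hmem⟩)
    have := eq_zero_of_tendsto_deriv (fun t ht => hderiv t ht i) (hlim i) hd
    linarith
  · refine hM fun i w v m _ huv hvb hm => ?_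
    linarith [(hcmp i w v huv hvb).2 m hm]

end Flow

end CirclePacking

end

theorem theorem4p2 {V : Type*} (T : AbstractSimplicialComplex V)
    (hT : CirclePacking.IsInfiniteDiskTriangulation T)
    (Φ : Sym2 V → ℝ) (hΦ : ∀ e ∈ CirclePacking.edges T, Φ e ∈ Set.Icc 0 (Real.pi / 2))
    (Khat : V → ℝ) (hKhat : ∀ i, Khat i < 2 * Real.pi)
    (u₀ : V → ℝ) (hu₀ : CirclePacking.IsConformalFactor u₀)
    (hle : ∀ i, CirclePacking.K T Φ u₀ i ≤ Khat i) :
    (∃ u : ℝ → V → ℝ, CirclePacking.IsFlowSolution T Φ Khat u ∧ u 0 = u₀ ∧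
      ∃ uLim : V → ℝ, CirclePacking.IsConformalFactor uLim ∧
        (∀ i, Filter.Tendsto (fun t => u t i) Filter.atTop (nhds (uLim i))) ∧
        ∀ i, CirclePacking.K T Φ uLim i = Khat i) ∧
    ((∃ C : ℝ, ∀ i, |CirclePacking.K T Φ u₀ i| ≤ C) →
      ∃ u : ℝ → V → ℝ,
        (CirclePacking.IsFlowSolution T Φ Khat u ∧ u 0 = u₀ ∧
          CirclePacking.IsSmoothInTime u ∧
          CirclePacking.IsSmoothInTime (fun t => CirclePacking.K T Φ (u t)) ∧
          CirclePacking.HasBoundedCurvature T Φ u) ∧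
        ∀ v : ℝ → V → ℝ,
          CirclePacking.IsFlowSolution T Φ Khat v → v 0 = u₀ →
          CirclePacking.HasBoundedCurvature T Φ v →
          ∀ t, 0 ≤ t → v t = u t) := by
  have hfin := hT.locallyFinite
  obtain ⟨u, hu, h0, hlim, hM⟩ := CirclePacking.exists_flowSolution hfin hΦ hKhat hu₀ hle
  refine ⟨⟨u, hu, h0, hlim⟩, ?_⟩
  rintro ⟨C, hC⟩
  have hpi := Real.pi_pos
  have hbd : CirclePacking.HasBoundedCurvature T Φ u := by
    -- The initial velocity is at most M = 2π + |C|, and this persists, so K ≥ Khat - M ≥ K(u₀) - M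
    -- ≥ -C - M; above, K ≤ 2π.
    refine ⟨2 * Real.pi + 2 * |C|, fun t ht i => ?_⟩
    have hCabs := le_abs_self C
    have h1 := CirclePacking.K_le_two_pi hfin hΦ i (hu.conformal t ht)
    have h2 := hM (2 * Real.pi + |C|) (by positivity) (fun j => by
      linarith [hKhat j, (abs_le.1 (hC j)).1]) t ht i
    have h3 := (abs_le.1 (hC i)).1
    have h4 := abs_nonneg C
    exact abs_le.2 ⟨by linarith [hle i], by linarith⟩
  exact ⟨u, ⟨hu, h0, hu.isSmoothInTime hfin hΦ, hu.isSmoothInTime_K hfin hΦ, hbd⟩,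
    fun v hv hv0 hbv t ht => hv.eq_of_bounded hfin hΦ hu (hv0.trans h0.symm) hbv hbd ht⟩
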